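/- Let $0<\alpha<1$. For $z\in\mathbb C\setminus\,]-\infty,0]$ put $$G_\alpha(z)=\frac1{2i\pi}\int_0^\infty \frac{e^{-e^{-i\pi\alpha}y^\alpha z^{1-\alpha}}-e^{-e^{i\pi\alpha}y^\alpha z^{1-\alpha}}}{z}\,e^{-y}\,dy,$$ where powers $z^h$ are the determinations that are positive on $]0,+\infty[$ and analytic on $\mathbb C\setminus\,]-\infty,0]$. Let $$\delta=(1-\alpha)\,\alpha^{\frac{\alpha}{1-\alpha}},\qquad c=\bigl(2\pi(1-\alpha)\bigr)^{-\frac12}\,\alpha^{\frac1{2(1-\alpha)}} .$$ (a) For every fixed $\theta\in\,]-1,1[$, as $r\to+\infty$ with $z=re^{i\pi\theta}$, one has $G_\alpha(z)\sim c\,z^{-1/2}e^{-\delta z}$. (b) For every $r>0$ the boundary values $G_\alpha(-r^+)=\lim_{z\to-r,\ \Im z>0}G_\alpha(z)$ and $G_\alpha(-r^-)=\lim_{z\to-r,\ \Im z<0}G_\alpha(z)$ exist, and, as $r\to+\infty$, $$G_\alpha(-r^+)\sim -i\,c\,r^{-1/2}e^{\delta r},\qquad G_\alpha(-r^-)\sim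 i\,c\,r^{-1/2}e^{\delta r}.$$ (c) There is $R>0$ such that the function $G_\alpha(z)\,z^{1/2}e^{\delta z}$ is bounded on $\{z\in\mathbb C\setminus\,]-\infty,0] : |z|>R\}$. -/

import Mathlib

open Filter Topology MeasureTheory Asymptotics

noncomputable section

/-- The function `G_α(z) = (2iπ)⁻¹ ∫₀^∞ (exp(-e^{-iπα} y^α z^{1-α}) - exp(-e^{iπα} y^α z^{1-α})) / z · e^{-y} dy`.
Mathlib's complex power is the principal determination, which is positive on the positive
half-line and analytic on the plane cut along the nonpositive real axis. -/
def stableG (α : ℝ) (z : ℂ) : ℂ :=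
  (2 * Complex.I * (Real.pi : ℂ))⁻¹ *
    ∫ y in Set.Ioi (0 : ℝ),
      (Complex.exp (-(Complex.exp (-(Complex.I * (Real.pi : ℂ) * (α : ℂ))) *
            ((y ^ α : ℝ) : ℂ) * z ^ ((1 - α : ℝ) : ℂ))) -
        Complex.exp (-(Complex.exp (Complex.I * (Real.pi : ℂ) * (α : ℂ)) *
            ((y ^ α : ℝ) : ℂ) * z ^ ((1 - α : ℝ) : ℂ)))) / z *
        Complex.exp (-(y : ℂ))

/-- The boundary value `G_α(-r⁺)`: the limit of `G_α(z)` as `z → -r` with `Im z > 0`. -/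
def stableGPlus (α r : ℝ) : ℂ :=
  limUnder (𝓝[{z : ℂ | 0 < z.im}] (-(r : ℂ))) (stableG α)

/-- The boundary value `G_α(-r⁻)`: the limit of `G_α(z)` as `z → -r` with `Im z < 0`. -/
def stableGMinus (α r : ℝ) : ℂ :=
  limUnder (𝓝[{z : ℂ | z.im < 0}] (-(r : ℂ))) (stableG α)

/-- The exponential rate `δ = (1-α) α^{α/(1-α)}`. -/
def stableDelta (α : ℝ) : ℝ := (1 - α) * α ^ (α / (1 - α))

/-- The constant `c = (2π(1-α))^{-1/2} α^{1/(2(1-α))}`. -/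
def stableC (α : ℝ) : ℝ :=
  (2 * Real.pi * (1 - α)) ^ (-(1 / 2) : ℝ) * α ^ (1 / (2 * (1 - α)))

end

/-!
In the logarithmic variable `ζ = log z`, the function `G_α` is the difference of two translates of
one entire function: with `Λ(ζ) = ∫₀^∞ exp (-y + y ^ α e^{(1 - α) ζ}) dy`,
`2πi z G_α(z) = Λ(ζ + iπ) - Λ(ζ - iπ)`. All the claims follow from one uniform statement: the entire
function `T(ζ) = exp (δ e^ζ) (Λ(ζ + iπ) - Λ(ζ - iπ))` satisfies `T(ζ) = (2πi c + o(1)) e^{ζ / 2}` as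
`Re ζ → ∞`, uniformly for `|Im ζ| ≤ π` (`exists_norm_stableRemainder_le`). The closed strip includes
the two sides of the cut, which gives the boundary values.

On the edges `Im ζ = ±π` one of the two terms is `Λ` at a real point, where the integrand is
positive and Laplace's method applies (`tendsto_stableBranch_ofReal`); the other is exponentially
smaller (`exists_norm_stableBranch_two_pi_le`). The Phragmén–Lindelöf principle carries the
asymptotics from the edges to the whole strip, provided that `T` is known to have at most polynomial
growth in `e^ζ`. By the same principle in strips of width `π / 2`, where the a priori bound
`exp (C e^{Re ζ})` is admissible, it is enough to prove such growth on the lines `Im ζ = 0`,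
`±π / 2`, `±π`.

On `Im ζ = ±π / 2` each term is bounded separately after rotating the ray of integration
(`expPowIntegral_rotate`, `exists_norm_stableJump_pi_div_two_le`). On the real line the two terms
cancel to leading order; there the difference is an integral of `exp (x (s - s ^ α))` around the
negative axis, which Cauchy's theorem moves to the vertical line through the saddle point
`s₀ = α ^ (1 / (1 - α))`. On that line `Re (s - s ^ α) ≤ -δ`, which is exactly the decay required
(`exists_norm_stableJump_real_le`).
-/

/-! ### Holomorphic parameter integrals -/

/-- An integral of functions holomorphic in `z` is holomorphic in `z` if the integrands are locally
uniformly dominated. No bound on the derivatives is assumed: Cauchy's estimate supplies it. -/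
theorem differentiableOn_integral_of_dominated {X : Type*} [MeasurableSpace X] {μ : Measure X}
    {U : Set ℂ} (hU : IsOpen U) {F : ℂ → X → ℂ}
    (hmeas : ∀ z ∈ U, AEStronglyMeasurable (F z) μ)
    (hdiff : ∀ x, DifferentiableOn ℂ (fun z => F z x) U)
    (hbound : ∀ z₀ ∈ U, ∃ V ∈ 𝓝 z₀, ∃ g : X → ℝ, Integrable g μ ∧
      ∀ᵐ x ∂μ, ∀ z ∈ V, ‖F z x‖ ≤ g x) :
    DifferentiableOn ℂ (fun z => ∫ x, F z x ∂μ) U := by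
  intro z₀ hz₀
  obtain ⟨V, hV, g, hg, hFg⟩ := hbound z₀ hz₀
  obtain ⟨r, hr, hrs⟩ := Metric.mem_nhds_iff.1 (inter_mem (hU.mem_nhds hz₀) hV)
  have hr4 : 0 < r / 4 := by positivity
  have hsub : ∀ z ∈ Metric.ball z₀ (r / 4), Metric.closedBall z (r / 4) ⊆ U ∩ V := by
    intro z hz w hw
    apply hrs
    rw [Metric.mem_ball] at hz ⊢
    rw [Metric.mem_closedBall] at hw
    have := dist_triangle w z z₀
    linarith
  have hz₀' : z₀ ∈ Metric.ball z₀ (r / 4) := Metric.mem_ball_self hr4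
  have hdat : ∀ x, ∀ z ∈ Metric.ball z₀ (r / 4),
      HasDerivAt (fun z => F z x) (deriv (fun z => F z x) z) z := by
    intro x z hz
    have hzU : z ∈ U := (hsub z hz (Metric.mem_closedBall_self hr4.le)).1
    exact ((hdiff x).differentiableAt (hU.mem_nhds hzU)).hasDerivAt
  have key := hasDerivAt_integral_of_dominated_loc_of_deriv_le (μ := μ) (F := F)
    (F' := fun z x => deriv (fun z => F z x) z) (x₀ := z₀) (bound := fun x => g x / (r / 4))
    (Metric.ball_mem_nhds z₀ hr4) ?_ ?_ ?_ ?_ ?_ ?_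
  · exact key.2.differentiableAt.differentiableWithinAt
  · filter_upwards [hU.mem_nhds hz₀] with z hz using hmeas z hz
  · exact hg.mono' (hmeas z₀ hz₀) (hFg.mono fun x hx => hx z₀ (mem_of_mem_nhds hV))
  · -- the derivative is a limit of difference quotients, hence measurable
    obtain ⟨u, -, hu_mem, hu⟩ := exists_seq_strictAnti_tendsto' (x := (0 : ℝ)) hr4
    have hu0 : Tendsto (fun n => z₀ + (u n : ℂ)) atTop (𝓝[≠] z₀) := by
      refine tendsto_nhdsWithin_iff.2 ⟨?_, Eventually.of_forall fun n => ?_⟩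
      · have := (Complex.continuous_ofReal.tendsto 0).comp hu
        simpa using this.const_add z₀
      · have := (hu_mem n).1.ne'
        simpa using this
    have huU : ∀ n, z₀ + (u n : ℂ) ∈ U := by
      intro n
      refine (hsub z₀ hz₀' ?_).1
      simp only [Metric.mem_closedBall, dist_self_add_left, Complex.norm_real, Real.norm_eq_abs]
      rw [abs_of_pos (hu_mem n).1]
      exact (hu_mem n).2.le
    refine aestronglyMeasurable_of_tendsto_ae atTop
      (f := fun n x => slope (fun z => F z x) z₀ (z₀ + (u n : ℂ))) (fun n => ?_)
      (Eventually.of_forall fun x => ?_)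
    · have h := ((hmeas _ (huU n)).sub (hmeas z₀ hz₀)).const_smul (z₀ + (u n : ℂ) - z₀)⁻¹
      exact h
    · exact ((hasDerivAt_iff_tendsto_slope.1 (hdat x z₀ hz₀')).comp hu0)
  · filter_upwards [hFg] with x hx z hz
    refine Complex.norm_deriv_le_of_forall_mem_sphere_norm_le hr4 ?_ ?_
    · refine DifferentiableOn.diffContOnCl ?_
      rw [closure_ball _ hr4.ne']
      exact (hdiff x).mono fun w hw => (hsub z hz hw).1
    · intro w hw
      exact hx w (hsub z hz (Metric.sphere_subset_closedBall hw)).2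
  · exact hg.div_const _
  · exact Eventually.of_forall hdat

/-! ### Integrals of `exp (-t * p + t ^ α * q)` -/

theorem exists_rpow_le_mul_add {α : ℝ} (hα₀ : 0 < α) (hα₁ : α < 1) {ε : ℝ} (hε : 0 < ε) :
    ∃ C : ℝ, 0 ≤ C ∧ ∀ t : ℝ, 0 ≤ t → t ^ α ≤ ε * t + C := by
  refine ⟨(1 - α) * (ε ^ (-(α / (1 - α)))), by have := sub_pos.2 hα₁; positivity, fun t ht => ?_⟩
  have h1 : 0 < 1 - α := sub_pos.2 hα₁
  have h := Real.geom_mean_le_arith_mean2_weighted hα₀.le h1.le (p₁ := ε * t)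
    (p₂ := ε ^ (-(α / (1 - α)))) (by positivity) (by positivity) (by ring)
  rw [Real.mul_rpow hε.le ht, ← Real.rpow_mul hε.le] at h
  have h2 : -(α / (1 - α)) * (1 - α) = -α := by field_simp
  rw [h2, mul_right_comm, ← Real.rpow_add hε, add_neg_cancel, Real.rpow_zero, one_mul] at h
  have : α * (ε * t) ≤ 1 * (ε * t) := by gcongr
  linarith

/-- `δ` is the maximum of `t ^ α - t` over `t ≥ 0`. -/
theorem rpow_le_self_add_stableDelta {α : ℝ} (hα₀ : 0 < α) (hα₁ : α < 1) {t : ℝ} (ht : 0 ≤ t) :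
    t ^ α ≤ t + stableDelta α := by
  have h1 : 0 < 1 - α := sub_pos.2 hα₁
  have h := Real.geom_mean_le_arith_mean2_weighted hα₀.le h1.le (p₁ := t / α)
    (p₂ := α ^ (α / (1 - α))) (by positivity) (by positivity) (by ring)
  rw [Real.div_rpow ht hα₀.le, ← Real.rpow_mul hα₀.le] at h
  have h2 : α / (1 - α) * (1 - α) = α := by field_simp
  rw [h2, div_mul_cancel₀ _ (by positivity), mul_div_cancel₀ _ hα₀.ne'] at h
  exact h

theorem stableDelta_pos {α : ℝ} (hα₀ : 0 < α) (hα₁ : α < 1) : 0 < stableDelta α := by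
  have : 0 < 1 - α := sub_pos.2 hα₁
  unfold stableDelta
  positivity

theorem integrableOn_exp_neg_mul_add_rpow {α : ℝ} (hα₀ : 0 < α) (hα₁ : α < 1) {m : ℝ} (hm : 0 < m)
    (M : ℝ) : IntegrableOn (fun t : ℝ => Real.exp (-t * m + t ^ α * M)) (Set.Ioi 0) := by
  obtain ⟨C, hC, h⟩ := exists_rpow_le_mul_add hα₀ hα₁ (ε := m / (2 * (|M| + 1))) (by positivity)
  refine Integrable.mono' (g := fun t => Real.exp (C * (|M| + 1)) * Real.exp (-(m / 2) * t))
    ((exp_neg_integrableOn_Ioi 0 (half_pos hm)).const_mul _) ?_ ?_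
  · refine Continuous.aestronglyMeasurable ?_
    exact ((continuous_id.neg.mul_const m).add
      ((Real.continuous_rpow_const hα₀.le).mul_const M)).rexp
  · refine (ae_restrict_iff' measurableSet_Ioi).2 (Eventually.of_forall fun t ht => ?_)
    have ht : 0 ≤ t := le_of_lt ht
    rw [Real.norm_eq_abs, Real.abs_exp, ← Real.exp_add, Real.exp_le_exp]
    have h1 : t ^ α * M ≤ t ^ α * (|M| + 1) := by
      gcongr
      linarith [le_abs_self M]
    have h2 : t ^ α * (|M| + 1) ≤ (m / (2 * (|M| + 1)) * t + C) * (|M| + 1) := by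
      gcongr; exact h t ht
    have h3 : (m / (2 * (|M| + 1)) * t + C) * (|M| + 1) = m / 2 * t + C * (|M| + 1) := by
      field_simp
    linarith

/-- The integral `∫₀^∞ exp (-t p + t ^ α q) dt`, which converges for `Re p > 0` and every `q`. -/
noncomputable def expPowIntegral (α : ℝ) (p q : ℂ) : ℂ :=
  ∫ t in Set.Ioi (0 : ℝ), Complex.exp (-(t : ℂ) * p + ((t ^ α : ℝ) : ℂ) * q)

theorem norm_expPow (α t : ℝ) (p q : ℂ) :
    ‖Complex.exp (-(t : ℂ) * p + ((t ^ α : ℝ) : ℂ) * q)‖ =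
      Real.exp (-t * p.re + t ^ α * q.re) := by
  rw [Complex.norm_exp]
  congr 1
  simp

theorem continuous_expPow {α : ℝ} (hα₀ : 0 < α) (p q : ℂ) :
    Continuous fun t : ℝ => Complex.exp (-(t : ℂ) * p + ((t ^ α : ℝ) : ℂ) * q) :=
  ((Complex.continuous_ofReal.neg.mul_const p).add
    ((Complex.continuous_ofReal.comp (Real.continuous_rpow_const hα₀.le)).mul_const q)).cexp

theorem integrableOn_expPow {α : ℝ} (hα₀ : 0 < α) (hα₁ : α < 1) {p : ℂ} (hp : 0 < p.re) (q : ℂ) :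
    IntegrableOn (fun t : ℝ => Complex.exp (-(t : ℂ) * p + ((t ^ α : ℝ) : ℂ) * q))
      (Set.Ioi 0) := by
  refine (integrableOn_exp_neg_mul_add_rpow hα₀ hα₁ hp q.re).mono'
    (continuous_expPow hα₀ p q).aestronglyMeasurable ?_
  exact Eventually.of_forall fun t => (norm_expPow α t p q).le

theorem norm_expPowIntegral_le {α : ℝ} (hα₀ : 0 < α) (hα₁ : α < 1) {p q : ℂ} {m M : ℝ}
    (hm : 0 < m) (hp : m ≤ p.re) (hq : q.re ≤ M) :
    ‖expPowIntegral α p q‖ ≤ ∫ t in Set.Ioi (0 : ℝ), Real.exp (-t * m + t ^ α * M) := by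
  refine norm_integral_le_of_norm_le (integrableOn_exp_neg_mul_add_rpow hα₀ hα₁ hm M) ?_
  refine (ae_restrict_iff' measurableSet_Ioi).2 (Eventually.of_forall fun t ht => ?_)
  have ht : 0 ≤ t := le_of_lt ht
  rw [norm_expPow, Real.exp_le_exp]
  have h1 : t * m ≤ t * p.re := by gcongr
  have h2 : t ^ α * q.re ≤ t ^ α * M := by gcongr
  linarith

theorem differentiableOn_expPowIntegral {α : ℝ} (hα₀ : 0 < α) (hα₁ : α < 1) {U : Set ℂ}
    (hU : IsOpen U) {p q : ℂ → ℂ} (hp : DifferentiableOn ℂ p U) (hq : DifferentiableOn ℂ q U)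
    (hp0 : ∀ z ∈ U, 0 < (p z).re) :
    DifferentiableOn ℂ (fun z => expPowIntegral α (p z) (q z)) U := by
  refine differentiableOn_integral_of_dominated hU
    (fun z _ => (continuous_expPow hα₀ _ _).aestronglyMeasurable) (fun t => ?_) (fun z₀ hz₀ => ?_)
  · exact ((hp.const_mul _).add (hq.const_mul _)).cexp
  · have hpc := (Complex.continuous_re.continuousAt.comp (hp.continuousOn.continuousAt
      (hU.mem_nhds hz₀)))
    have hqc := (Complex.continuous_re.continuousAt.comp (hq.continuousOn.continuousAt
      (hU.mem_nhds hz₀)))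
    have h0 := hp0 z₀ hz₀
    have h1 : ∀ᶠ z in 𝓝 z₀, (p z₀).re / 2 < (p z).re :=
      hpc.eventually (lt_mem_nhds (half_lt_self h0))
    have h2 : ∀ᶠ z in 𝓝 z₀, (q z).re < (q z₀).re + 1 :=
      hqc.eventually (gt_mem_nhds (lt_add_one _))
    refine ⟨_, h1.and h2, _, integrableOn_exp_neg_mul_add_rpow hα₀ hα₁ (half_pos h0)
      ((q z₀).re + 1), ?_⟩
    refine (ae_restrict_iff' measurableSet_Ioi).2 (Eventually.of_forall fun t ht z hz => ?_)
    have ht : 0 ≤ t := le_of_lt ht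
    rw [norm_expPow, Real.exp_le_exp]
    have h3 : t * ((p z₀).re / 2) ≤ t * (p z).re := by gcongr; exact hz.1.le
    have h4 : t ^ α * (q z).re ≤ t ^ α * ((q z₀).re + 1) := by gcongr; exact hz.2.le
    linarith

theorem expPowIntegral_scale {α : ℝ} (x : ℝ) (w : ℂ) :
    Complex.exp x * expPowIntegral α (Complex.exp x) (Complex.exp (α * x) * w) =
      expPowIntegral α 1 w := by
  have h := integral_comp_mul_left_Ioi
    (fun t : ℝ => Complex.exp (-(t : ℂ) * 1 + ((t ^ α : ℝ) : ℂ) * w)) 0 (Real.exp_pos x)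
  unfold expPowIntegral
  rw [mul_zero] at h
  rw [show Complex.exp (x : ℂ) = ((Real.exp x : ℝ) : ℂ) by push_cast; rfl]
  have h' : ∫ t in Set.Ioi (0 : ℝ), Complex.exp (-(t : ℂ) * ((Real.exp x : ℝ) : ℂ) +
      ((t ^ α : ℝ) : ℂ) * (Complex.exp (α * x) * w)) = ∫ t in Set.Ioi (0 : ℝ),
      Complex.exp (-((Real.exp x * t : ℝ) : ℂ) * 1 + (((Real.exp x * t) ^ α : ℝ) : ℂ) * w) := by
    refine setIntegral_congr_fun measurableSet_Ioi fun t ht => ?_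
    have ht : 0 ≤ t := le_of_lt ht
    rw [Real.mul_rpow (Real.exp_pos x).le ht, ← Real.exp_mul, mul_comm x α]
    push_cast
    ring_nf
  rw [h', h, Complex.real_smul, ← mul_assoc, ← Complex.ofReal_mul,
    mul_inv_cancel₀ (Real.exp_pos x).ne', Complex.ofReal_one, one_mul]

/-- Rotation of the ray of integration `t ↦ e^η t`. For real `η` it is a substitution; both sides
are holomorphic in `η` on the strip `|Im η| < π / 2`. -/
theorem expPowIntegral_rotate {α : ℝ} (hα₀ : 0 < α) (hα₁ : α < 1) {η : ℂ}
    (hη : |η.im| < Real.pi / 2) (w : ℂ) :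
    Complex.exp η * expPowIntegral α (Complex.exp η) (Complex.exp (α * η) * w) =
      expPowIntegral α 1 w := by
  set U : Set ℂ := Complex.im ⁻¹' Set.Ioo (-(Real.pi / 2)) (Real.pi / 2) with hUdef
  have hU : IsOpen U := isOpen_Ioo.preimage Complex.continuous_im
  have hconv : Convex ℝ U := (convex_Ioo _ _).linear_preimage Complex.imLm
  have hd : DifferentiableOn ℂ (fun η => Complex.exp η *
      expPowIntegral α (Complex.exp η) (Complex.exp (α * η) * w)) U := by
    refine Complex.differentiable_exp.differentiableOn.mul ?_
    refine differentiableOn_expPowIntegral hα₀ hα₁ hU Complex.differentiable_exp.differentiableOn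
      (Differentiable.differentiableOn (by fun_prop)) fun z hz => ?_
    rw [Complex.exp_re]
    exact mul_pos (Real.exp_pos _) (Real.cos_pos_of_mem_Ioo hz)
  have h0U : (0 : ℂ) ∈ U := by simp [hUdef, Real.pi_pos]
  have key := (hd.analyticOnNhd hU).eqOn_of_preconnected_of_frequently_eq
    (analyticOnNhd_const (v := expPowIntegral α 1 w)) hconv.isPreconnected h0U ?_
  · exact key (x := η) (abs_lt.1 hη)
  · have hu : Tendsto (fun n : ℕ => (((1 / ((n : ℝ) + 1) : ℝ)) : ℂ)) atTop (𝓝[≠] 0) := by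
      refine tendsto_nhdsWithin_iff.2 ⟨?_, Eventually.of_forall fun n => ?_⟩
      · have := (Complex.continuous_ofReal.tendsto 0).comp
          (tendsto_one_div_add_atTop_nhds_zero_nat (𝕜 := ℝ))
        simpa [Function.comp_def] using this
      · have : (0 : ℝ) < 1 / ((n : ℝ) + 1) := by positivity
        have h2 := this.ne'
        simp only [Set.mem_compl_iff, Set.mem_singleton_iff, Complex.ofReal_eq_zero]
        exact h2
    exact hu.frequently (Frequently.of_forall fun n => expPowIntegral_scale _ w)

theorem expPowIntegral_conj (α : ℝ) (p q : ℂ) :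
    expPowIntegral α (starRingEnd ℂ p) (starRingEnd ℂ q) =
      starRingEnd ℂ (expPowIntegral α p q) := by
  unfold expPowIntegral
  rw [← integral_conj]
  refine integral_congr_ae (Eventually.of_forall fun t => ?_)
  simp only [← Complex.exp_conj, map_add, map_mul, map_neg, Complex.conj_ofReal]

/-! ### The two branches and their difference -/

theorem integral_exp_neg_mul_add_rpow_le {α : ℝ} {m M B k : ℝ} (hk : 0 < k)
    (h : ∀ t : ℝ, 0 ≤ t → -t * m + t ^ α * M ≤ B - k * t) :
    ∫ t in Set.Ioi (0 : ℝ), Real.exp (-t * m + t ^ α * M) ≤ Real.exp B / k := by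
  have hi : IntegrableOn (fun t : ℝ => Real.exp B * Real.exp (-k * t)) (Set.Ioi 0) :=
    (exp_neg_integrableOn_Ioi 0 hk).const_mul _
  calc _ ≤ ∫ t in Set.Ioi (0 : ℝ), Real.exp B * Real.exp (-k * t) := by
        refine integral_mono_of_nonneg (Eventually.of_forall fun t => (Real.exp_pos _).le) hi ?_
        refine (ae_restrict_iff' measurableSet_Ioi).2 (Eventually.of_forall fun t ht => ?_)
        have := h t (le_of_lt ht)
        simp only [← Real.exp_add]
        rw [Real.exp_le_exp]
        linarith
    _ = Real.exp B / k := by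
        rw [integral_const_mul, integral_exp_mul_Ioi (by linarith) 0]
        simp [div_eq_mul_inv]

/-- `Λ(ζ) = ∫₀^∞ exp (-y + y ^ α e^{(1 - α) ζ}) dy`, an entire function of the logarithmic variable
`ζ`. The two halves of the integral defining `G_α(z)` are `Λ(log z + iπ)` and `Λ(log z - iπ)`. -/
noncomputable def stableBranch (α : ℝ) (ζ : ℂ) : ℂ :=
  expPowIntegral α 1 (Complex.exp ((1 - α) * ζ))

theorem differentiable_stableBranch {α : ℝ} (hα₀ : 0 < α) (hα₁ : α < 1) :
    Differentiable ℂ (stableBranch α) := by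
  rw [← differentiableOn_univ]
  exact differentiableOn_expPowIntegral hα₀ hα₁ isOpen_univ (differentiableOn_const 1)
    (Differentiable.differentiableOn (by fun_prop)) (by simp)

theorem stableBranch_conj (α : ℝ) (ζ : ℂ) :
    stableBranch α (starRingEnd ℂ ζ) = starRingEnd ℂ (stableBranch α ζ) := by
  unfold stableBranch
  rw [← expPowIntegral_conj, map_one, ← Complex.exp_conj]
  simp

theorem stableBranch_eq_rotate {α : ℝ} (hα₀ : 0 < α) (hα₁ : α < 1) {η : ℂ}
    (hη : |η.im| < Real.pi / 2) (ζ : ℂ) :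
    stableBranch α ζ = Complex.exp η *
      expPowIntegral α (Complex.exp η) (Complex.exp (α * η + (1 - α) * ζ)) := by
  rw [Complex.exp_add, expPowIntegral_rotate hα₀ hα₁ hη]
  rfl

/-- Bound for `Λ` by a real integral along the ray of argument `χ`, where `χ` is free. -/
theorem norm_stableBranch_le {α : ℝ} (hα₀ : 0 < α) (hα₁ : α < 1) {χ : ℝ}
    (hχ : |χ| < Real.pi / 2) {ζ : ℂ} {m M : ℝ} (hm : 0 < m)
    (hm' : m ≤ Real.exp ζ.re * Real.cos χ)
    (hM : Real.exp ζ.re * Real.cos (α * χ + (1 - α) * ζ.im) ≤ M) :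
    ‖stableBranch α ζ‖ ≤
      Real.exp ζ.re * ∫ t in Set.Ioi (0 : ℝ), Real.exp (-t * m + t ^ α * M) := by
  have hη : |(⟨ζ.re, χ⟩ : ℂ).im| < Real.pi / 2 := hχ
  rw [stableBranch_eq_rotate hα₀ hα₁ hη, norm_mul, Complex.norm_exp]
  refine mul_le_mul_of_nonneg_left ?_ (Real.exp_pos _).le
  refine norm_expPowIntegral_le hα₀ hα₁ hm ?_ ?_
  · rw [Complex.exp_re]; exact hm'
  · rw [Complex.exp_re]
    convert hM using 3
    · simp; ring
    · simp

theorem exists_norm_stableBranch_le_exp {α : ℝ} (hα₀ : 0 < α) (hα₁ : α < 1) :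
    ∃ C : ℝ, 0 ≤ C ∧ ∀ ζ : ℂ, ‖stableBranch α ζ‖ ≤ 2 * Real.exp (C * Real.exp ζ.re) := by
  obtain ⟨C, hC, h⟩ := exists_rpow_le_mul_add hα₀ hα₁ (ε := 1 / 2) (by norm_num)
  refine ⟨C, hC, fun ζ => ?_⟩
  set x := Real.exp ζ.re
  have hx : 0 < x := Real.exp_pos _
  have h1 := norm_stableBranch_le hα₀ hα₁ (χ := 0) (by simp [Real.pi_pos]) (ζ := ζ) (m := x)
    (M := x) hx (by simp [x]) (mul_le_of_le_one_right hx.le (Real.cos_le_one _))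
  have h2 := integral_exp_neg_mul_add_rpow_le (α := α) (m := x) (M := x) (B := C * x)
    (k := x / 2) (by positivity) (fun t ht => by nlinarith [h t ht])
  calc _ ≤ x * (Real.exp (C * x) / (x / 2)) := h1.trans (by gcongr)
    _ = _ := by field_simp

/-- On the lines `Im ζ = ±2π` the growth rate of `Λ` is strictly less than `δ`. -/
theorem exists_norm_stableBranch_two_pi_le {α : ℝ} (hα₀ : 0 < α) (hα₁ : α < 1) :
    ∃ κ : ℝ, κ < 1 ∧ ∀ ζ : ℂ, |ζ.im| = 2 * Real.pi →
      ‖stableBranch α ζ‖ ≤ Real.exp (κ * stableDelta α * Real.exp ζ.re) / (1 - κ) := by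
  set κ := max 0 (Real.cos ((1 - α) * (2 * Real.pi)))
  have hκ0 : 0 ≤ κ := le_max_left _ _
  have hκ1 : κ < 1 := by
    refine max_lt one_pos (lt_of_le_of_ne (Real.cos_le_one _) fun h => ?_)
    have hp := Real.pi_pos
    have h1 : (1 - α) * (2 * Real.pi) < 2 * Real.pi := by nlinarith
    have h2 : 0 < (1 - α) * (2 * Real.pi) := mul_pos (sub_pos.2 hα₁) (by positivity)
    have := (Real.cos_eq_one_iff_of_lt_of_lt (by linarith) h1).1 h
    linarith
  refine ⟨κ, hκ1, fun ζ hζ => ?_⟩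
  have hcos : Real.cos (α * 0 + (1 - α) * ζ.im) ≤ κ := by
    refine le_trans (le_of_eq ?_) (le_max_right _ _)
    rw [mul_zero, zero_add, ← Real.cos_abs, abs_mul, hζ, abs_of_pos (sub_pos.2 hα₁)]
  set x := Real.exp ζ.re
  have hx : 0 < x := Real.exp_pos _
  have h1 := norm_stableBranch_le hα₀ hα₁ (χ := 0) (by simp [Real.pi_pos]) (ζ := ζ) (m := x)
    (M := x * κ) hx (by simp [x]) (by gcongr)
  have h2 := integral_exp_neg_mul_add_rpow_le (α := α) (m := x) (M := x * κ)
    (B := κ * stableDelta α * x) (k := x * (1 - κ)) (mul_pos hx (sub_pos.2 hκ1)) (fun t ht => by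
      have := mul_le_mul_of_nonneg_right (rpow_le_self_add_stableDelta hα₀ hα₁ ht)
        (mul_nonneg hx.le hκ0)
      nlinarith)
  have h3 : 0 < 1 - κ := sub_pos.2 hκ1
  calc _ ≤ x * (Real.exp (κ * stableDelta α * x) / (x * (1 - κ))) := h1.trans (by gcongr)
    _ = _ := by field_simp

theorem exists_norm_stableBranch_pi_div_two_le {α : ℝ} (hα₀ : 0 < α) (hα₁ : α < 1) :
    ∃ C : ℝ, ∀ ζ : ℂ, 0 ≤ ζ.re → ζ.im = Real.pi / 2 →
      ‖stableBranch α ζ‖ ≤ C * Real.exp ζ.re := by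
  refine ⟨∫ t in Set.Ioi (0 : ℝ), Real.exp (-t * (2 / Real.pi) + t ^ α * 1), fun ζ h0 hζ => ?_⟩
  rw [mul_comm]
  have hp := Real.pi_gt_three
  have hx : 1 ≤ Real.exp ζ.re := Real.one_le_exp h0
  -- rotation by `π / 2 - η` with `η = exp (-Re ζ)` makes the integral bounded independently of `ζ`
  set η := (Real.exp ζ.re)⁻¹ with hη
  have hη0 : 0 < η := by positivity
  have hη1 : η ≤ 1 := inv_le_one_of_one_le₀ hx
  have hxη : Real.exp ζ.re * η = 1 := mul_inv_cancel₀ (Real.exp_pos _).ne'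
  refine norm_stableBranch_le hα₀ hα₁ (χ := Real.pi / 2 - η) ?_ (by positivity) ?_ ?_
  · rw [abs_lt]; constructor <;> linarith
  · rw [Real.cos_pi_div_two_sub]
    have := Real.mul_le_sin hη0.le (by linarith)
    calc 2 / Real.pi = Real.exp ζ.re * (2 / Real.pi * η) := by
          rw [mul_left_comm, hxη, mul_one]
      _ ≤ _ := by gcongr
  · rw [hζ, show α * (Real.pi / 2 - η) + (1 - α) * (Real.pi / 2) = Real.pi / 2 - α * η by ring,
      Real.cos_pi_div_two_sub]
    have := Real.sin_le (x := α * η) (by positivity)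
    calc _ ≤ Real.exp ζ.re * η := by
          gcongr
          nlinarith
      _ = 1 := hxη

/-- On the line `Im ζ = 3π / 2` a ray of argument slightly below `π / 2` makes both terms of the
exponent have nonpositive real part, so that `Λ` is bounded there. -/
theorem exists_norm_stableBranch_three_pi_div_two_le {α : ℝ} (hα₀ : 0 < α) (hα₁ : α < 1) :
    ∃ C : ℝ, ∀ ζ : ℂ, ζ.im = 3 * Real.pi / 2 → ‖stableBranch α ζ‖ ≤ C := by
  refine ⟨1 / Real.sin (1 - α), fun ζ hζ => ?_⟩
  have hp := Real.pi_gt_three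
  have h1 : 0 < 1 - α := sub_pos.2 hα₁
  have hs : 0 < Real.sin (1 - α) := Real.sin_pos_of_pos_of_lt_pi h1 (by linarith)
  have hx : 0 < Real.exp ζ.re := Real.exp_pos _
  have h2 := norm_stableBranch_le hα₀ hα₁ (χ := Real.pi / 2 - (1 - α)) (ζ := ζ)
    (m := Real.exp ζ.re * Real.sin (1 - α)) (M := 0) ?_ (by positivity) ?_ ?_
  · have h3 := integral_exp_neg_mul_add_rpow_le (α := α) (m := Real.exp ζ.re * Real.sin (1 - α))
      (M := 0) (B := 0) (k := Real.exp ζ.re * Real.sin (1 - α)) (by positivity)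
      (fun t _ => by linarith)
    calc _ ≤ Real.exp ζ.re * (Real.exp 0 / (Real.exp ζ.re * Real.sin (1 - α))) :=
          h2.trans (by gcongr)
      _ = _ := by rw [Real.exp_zero]; field_simp
  · rw [abs_lt]; constructor <;> linarith
  · rw [Real.cos_pi_div_two_sub]
  · rw [hζ, show α * (Real.pi / 2 - (1 - α)) + (1 - α) * (3 * Real.pi / 2) =
      (1 - α) * (Real.pi - α) + Real.pi / 2 by ring, Real.cos_add_pi_div_two]
    have : 0 ≤ Real.sin ((1 - α) * (Real.pi - α)) :=
      Real.sin_nonneg_of_nonneg_of_le_pi (mul_nonneg h1.le (by linarith)) (by nlinarith)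
    nlinarith

/-- `T(ζ) = exp (δ e^ζ) (Λ(ζ + iπ) - Λ(ζ - iπ))`. For `ζ = log z` it equals
`2πi z e^{δ z} G_α(z)`. -/
noncomputable def stableJump (α : ℝ) (ζ : ℂ) : ℂ :=
  Complex.exp (stableDelta α * Complex.exp ζ) *
    (stableBranch α (ζ + Real.pi * Complex.I) - stableBranch α (ζ - Real.pi * Complex.I))

theorem differentiable_stableJump {α : ℝ} (hα₀ : 0 < α) (hα₁ : α < 1) :
    Differentiable ℂ (stableJump α) := by
  have h := differentiable_stableBranch hα₀ hα₁
  unfold stableJump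
  refine Differentiable.mul (by fun_prop) (Differentiable.sub ?_ ?_)
  · exact h.comp (differentiable_id.add_const _)
  · exact h.comp (differentiable_id.sub_const _)

theorem stableJump_conj (α : ℝ) (ζ : ℂ) :
    stableJump α (starRingEnd ℂ ζ) = -starRingEnd ℂ (stableJump α ζ) := by
  unfold stableJump
  have h1 : starRingEnd ℂ ζ + Real.pi * Complex.I =
      starRingEnd ℂ (ζ - Real.pi * Complex.I) := by simp
  have h2 : starRingEnd ℂ ζ - Real.pi * Complex.I =
      starRingEnd ℂ (ζ + Real.pi * Complex.I) := by simp [sub_eq_add_neg]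
  rw [h1, h2, stableBranch_conj, stableBranch_conj, map_mul, map_sub, ← Complex.exp_conj,
    map_mul, Complex.conj_ofReal, ← Complex.exp_conj]
  ring

theorem norm_stableJump_conj (α : ℝ) (ζ : ℂ) :
    ‖stableJump α (starRingEnd ℂ ζ)‖ = ‖stableJump α ζ‖ := by
  rw [stableJump_conj, norm_neg, RCLike.norm_conj]

theorem exists_norm_stableJump_le_exp {α : ℝ} (hα₀ : 0 < α) (hα₁ : α < 1) :
    ∃ C : ℝ, 0 ≤ C ∧ ∀ ζ : ℂ, ‖stableJump α ζ‖ ≤ 4 * Real.exp (C * Real.exp ζ.re) := by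
  obtain ⟨C, hC, h⟩ := exists_norm_stableBranch_le_exp hα₀ hα₁
  have hδ := stableDelta_pos hα₀ hα₁
  refine ⟨stableDelta α + C, by positivity, fun ζ => ?_⟩
  unfold stableJump
  have h1 := h (ζ + Real.pi * Complex.I)
  have h2 := h (ζ - Real.pi * Complex.I)
  simp only [Complex.add_re, Complex.sub_re, Complex.mul_I_re, Complex.ofReal_im, neg_zero,
    add_zero, sub_zero] at h1 h2
  have h3 : ‖Complex.exp (stableDelta α * Complex.exp ζ)‖ ≤
      Real.exp (stableDelta α * Real.exp ζ.re) := by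
    rw [Complex.norm_exp, Real.exp_le_exp, Complex.re_ofReal_mul]
    gcongr
    exact (Complex.re_le_norm _).trans (Complex.norm_exp _).le
  rw [norm_mul]
  calc _ ≤ Real.exp (stableDelta α * Real.exp ζ.re) *
        (2 * Real.exp (C * Real.exp ζ.re) + 2 * Real.exp (C * Real.exp ζ.re)) := by
        gcongr
        exact (norm_sub_le _ _).trans (add_le_add h1 h2)
    _ = _ := by rw [add_mul, Real.exp_add]; ring

theorem exists_norm_stableJump_pi_div_two_le {α : ℝ} (hα₀ : 0 < α) (hα₁ : α < 1) :
    ∃ A : ℝ, ∀ ζ : ℂ, ζ.im = Real.pi / 2 → 0 ≤ ζ.re → ‖stableJump α ζ‖ ≤ A * Real.exp ζ.re := by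
  obtain ⟨C₁, h₁⟩ := exists_norm_stableBranch_pi_div_two_le hα₀ hα₁
  obtain ⟨C₂, h₂⟩ := exists_norm_stableBranch_three_pi_div_two_le hα₀ hα₁
  refine ⟨max C₂ 0 + C₁, fun ζ hζ h0 => ?_⟩
  have h3 : ‖Complex.exp (stableDelta α * Complex.exp ζ)‖ = 1 := by
    rw [Complex.norm_exp, Complex.re_ofReal_mul, Complex.exp_re, hζ, Real.cos_pi_div_two]
    simp
  have h4 := h₂ (ζ + Real.pi * Complex.I) (by simp [hζ]; ring)
  have h5 : ‖stableBranch α (ζ - Real.pi * Complex.I)‖ ≤ C₁ * Real.exp ζ.re := by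
    have := h₁ (starRingEnd ℂ (ζ - Real.pi * Complex.I)) (by simpa using h0)
      (by simp [hζ]; ring)
    rw [stableBranch_conj, RCLike.norm_conj] at this
    simpa using this
  unfold stableJump
  rw [norm_mul, h3, one_mul]
  have h6 : C₂ ≤ max C₂ 0 * Real.exp ζ.re :=
    (le_max_left _ _).trans (le_mul_of_one_le_right (le_max_right _ _) (Real.one_le_exp h0))
  calc _ ≤ _ := norm_sub_le _ _
    _ ≤ max C₂ 0 * Real.exp ζ.re + C₁ * Real.exp ζ.re := add_le_add (h4.trans h6) h5
    _ = _ := by ring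

/-! ### Contour deformation through the saddle point -/

/-- The critical point `α ^ (1 / (1 - α))` of `s - s ^ α`, where its value is `-δ`. -/
noncomputable def saddlePoint (α : ℝ) : ℝ := α ^ (1 / (1 - α))

theorem saddlePoint_pos {α : ℝ} (hα₀ : 0 < α) : 0 < saddlePoint α := Real.rpow_pos_of_pos hα₀ _

theorem saddlePoint_rpow {α : ℝ} (hα₀ : 0 < α) (hα₁ : α < 1) :
    saddlePoint α ^ α = saddlePoint α / α := by
  have h1 : (1 - α) ≠ 0 := (sub_pos.2 hα₁).ne'
  unfold saddlePoint
  rw [← Real.rpow_mul hα₀.le, eq_div_iff hα₀.ne', ← Real.rpow_add_one hα₀.ne']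
  congr 1
  field_simp
  ring

theorem stableDelta_eq {α : ℝ} (hα₀ : 0 < α) (hα₁ : α < 1) :
    stableDelta α = saddlePoint α ^ α - saddlePoint α := by
  have h1 : (1 - α) ≠ 0 := (sub_pos.2 hα₁).ne'
  have h : α ^ (α / (1 - α)) = saddlePoint α ^ α := by
    unfold saddlePoint
    rw [← Real.rpow_mul hα₀.le]
    congr 1
    field_simp
  rw [stableDelta, h, saddlePoint_rpow hα₀ hα₁]
  field_simp

/-- Concavity of `cos` followed by the weighted arithmetic-geometric mean inequality. -/
theorem cos_rpow_le_cos_mul {α φ : ℝ} (hα₀ : 0 ≤ α) (hα₁ : α ≤ 1) (h0 : 0 ≤ φ)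
    (h1 : φ ≤ Real.pi / 2) : Real.cos φ ^ α ≤ Real.cos (α * φ) := by
  have hc := strictConcaveOn_cos_Icc.concaveOn.2 (x := φ) (y := 0) ⟨by linarith, h1⟩
    ⟨by linarith [Real.pi_pos], by linarith [Real.pi_pos]⟩ hα₀ (sub_nonneg.2 hα₁) (by ring)
  have ha := Real.geom_mean_le_arith_mean2_weighted hα₀ (sub_nonneg.2 hα₁) (p₁ := Real.cos φ)
    (p₂ := 1) (Real.cos_nonneg_of_neg_pi_div_two_le_of_le (by linarith) h1) zero_le_one (by ring)
  simp only [smul_eq_mul, mul_zero, add_zero, Real.cos_zero, Real.one_rpow, mul_one] at hc ha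
  linarith

/-- The phase `s - s ^ α` on the closed upper half-plane. The power is written as
`e^{iπα/2} (-i s) ^ α`, which agrees with `s ^ α` for `Im s ≥ 0` and keeps the cut of the principal
branch away from that half-plane. -/
noncomputable def saddlePhase (α : ℝ) (s : ℂ) : ℂ :=
  s - Complex.exp (Real.pi * α / 2 * Complex.I) * (-Complex.I * s) ^ (α : ℂ)

theorem saddlePhase_re (α : ℝ) (s : ℂ) : (saddlePhase α s).re =
    s.re - ‖s‖ ^ α * Real.cos (α * (Complex.arg (-Complex.I * s) + Real.pi / 2)) := by
  have h1 : Complex.exp (Real.pi * α / 2 * Complex.I) =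
      Real.cos (Real.pi * α / 2) + Real.sin (Real.pi * α / 2) * Complex.I := by
    rw [Complex.exp_mul_I]; push_cast; rfl
  unfold saddlePhase
  rw [Complex.cpow_ofReal, h1]
  have h2 : ‖-Complex.I * s‖ = ‖s‖ := by simp
  rw [h2]
  rw [show α * (Complex.arg (-Complex.I * s) + Real.pi / 2) =
    Real.pi * α / 2 + Complex.arg (-Complex.I * s) * α by ring, Real.cos_add]
  simp only [Complex.sub_re, Complex.mul_re, Complex.add_re, Complex.ofReal_re, Complex.I_re,
    Complex.ofReal_im, Complex.I_im, Complex.add_im, Complex.mul_im, mul_zero, mul_one, zero_mul,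
    sub_zero, add_zero, zero_add, sub_self]
  ring

theorem continuousOn_saddlePhase {α : ℝ} (hα₀ : 0 < α) :
    ContinuousOn (saddlePhase α) {s | 0 ≤ s.im} := by
  refine continuousOn_id.sub (continuousOn_const.mul ?_)
  intro s hs
  rcases eq_or_ne s 0 with rfl | h0
  · refine ContinuousAt.continuousWithinAt ?_
    have h := Complex.continuousAt_cpow_zero_of_re_pos (z := (α : ℂ)) (by simpa using hα₀)
    have h2 : ContinuousAt (fun s : ℂ => (-Complex.I * s, (α : ℂ))) 0 := by fun_prop
    have := ContinuousAt.comp_of_eq (g := fun x : ℂ × ℂ => x.1 ^ x.2) h h2 (by simp)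
    exact this
  · refine ContinuousAt.continuousWithinAt ?_
    refine ContinuousAt.cpow (by fun_prop) (by fun_prop) ?_
    have h1 : (-Complex.I * s).re = s.im := by simp
    have h2 : (-Complex.I * s).im = -s.re := by simp
    rw [Complex.mem_slitPlane_iff, h1, h2]
    rcases (show 0 ≤ s.im from hs).lt_or_eq with h | h
    · exact Or.inl h
    · right
      intro h3
      exact h0 (Complex.ext (by simpa using h3) h.symm)

theorem differentiableAt_saddlePhase (α : ℝ) {s : ℂ} (hs : 0 < s.im) :
    DifferentiableAt ℂ (saddlePhase α) s := by
  refine differentiableAt_id.sub ((differentiableAt_const _).mul ?_)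
  refine DifferentiableAt.cpow (by fun_prop) (by fun_prop) ?_
  rw [Complex.mem_slitPlane_iff]
  left
  simpa using hs

theorem saddlePhase_ofReal {α : ℝ} (hα₀ : 0 < α) {t : ℝ} (ht : 0 ≤ t) :
    saddlePhase α t = ((t - t ^ α : ℝ) : ℂ) := by
  rcases ht.eq_or_lt with rfl | ht
  · simp [saddlePhase, hα₀.ne', Real.zero_rpow]
  · unfold saddlePhase
    have h0 : (-Complex.I * t : ℂ) ≠ 0 := by simp [ht.ne']
    rw [Complex.cpow_def_of_ne_zero h0, ← Complex.exp_add, mul_comm (-Complex.I),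
      Complex.log_ofReal_mul ht (by simp), Complex.log_neg_I, Real.rpow_def_of_pos ht]
    push_cast
    congr 2
    ring

theorem saddlePhase_neg_ofReal {α : ℝ} (hα₀ : 0 < α) {t : ℝ} (ht : 0 ≤ t) :
    saddlePhase α (-t : ℝ) = -t - (t ^ α : ℝ) * Complex.exp (Real.pi * α * Complex.I) := by
  rcases ht.eq_or_lt with rfl | ht
  · simp [saddlePhase, hα₀.ne', Real.zero_rpow]
  · unfold saddlePhase
    have h0 : (-Complex.I * (-t : ℝ) : ℂ) ≠ 0 := by simp [ht.ne']
    rw [Complex.cpow_def_of_ne_zero h0, ← Complex.exp_add,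
      show -Complex.I * (-t : ℝ) = t * Complex.I by push_cast; ring,
      Complex.log_ofReal_mul ht (by simp), Complex.log_I, Real.rpow_def_of_pos ht]
    push_cast
    rw [← Complex.exp_add]
    congr 2
    ring

theorem exists_saddlePhase_re_le {α : ℝ} (hα₀ : 0 < α) (hα₁ : α < 1) (b : ℝ) :
    ∃ C c : ℝ, 0 < c ∧ ∀ s : ℂ, 0 ≤ s.im → s.re ≤ b →
      (saddlePhase α s).re ≤ C - c * ‖s‖ ^ α := by
  have hp := Real.pi_pos
  -- with `ω = arg s - π / 2`: for `ω ≤ ω₀` the term `s ^ α` has positive real part and `Re s ≤ b`,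
  -- while for `ω ≥ ω₀` the linear term `s` dominates
  set ω₀ := (1 - α) * (Real.pi / 2) with hω₀
  have hω₀0 : 0 < ω₀ := mul_pos (sub_pos.2 hα₁) (by positivity)
  have hω₀1 : ω₀ < Real.pi / 2 := by nlinarith
  have hσ : 0 < Real.sin ω₀ := Real.sin_pos_of_pos_of_lt_pi hω₀0 (by linarith)
  have hlt : α * (ω₀ + Real.pi / 2) < Real.pi / 2 := by
    rw [hω₀]; nlinarith [mul_pos (mul_pos (sub_pos.2 hα₁) (sub_pos.2 hα₁)) hp]
  have hc : 0 < Real.cos (α * (ω₀ + Real.pi / 2)) :=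
    Real.cos_pos_of_mem_Ioo ⟨by nlinarith, hlt⟩
  obtain ⟨C, hC, h⟩ := exists_rpow_le_mul_add hα₀ hα₁ (half_pos hσ)
  refine ⟨max b (2 * C), _, hc, fun s hs hb => ?_⟩
  set v := -Complex.I * s with hv
  have hvre : 0 ≤ v.re := by simpa [hv] using hs
  have hvn : ‖v‖ = ‖s‖ := by simp [hv]
  have hsre : s.re = -(‖s‖ * Real.sin v.arg) := by
    rw [← hvn, Complex.norm_mul_sin_arg]; simp [hv]
  have harg := abs_le.1 (Complex.abs_arg_le_pi_div_two_iff.2 hvre)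
  have hn : 0 ≤ ‖s‖ ^ α := by positivity
  rw [saddlePhase_re, ← hv]
  rcases le_total v.arg ω₀ with hω | hω
  · have : Real.cos (α * (ω₀ + Real.pi / 2)) ≤ Real.cos (α * (v.arg + Real.pi / 2)) := by
      refine Real.cos_le_cos_of_nonneg_of_le_pi (mul_nonneg hα₀.le (by linarith)) (by linarith) ?_
      gcongr
    have := mul_le_mul_of_nonneg_left this hn
    have := le_max_left b (2 * C)
    linarith
  · have h1 : Real.sin ω₀ ≤ Real.sin v.arg :=
      Real.sin_le_sin_of_le_of_le_pi_div_two (by linarith) harg.2 hω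
    have h2 := mul_le_mul_of_nonneg_left h1 (norm_nonneg s)
    have h3 := h ‖s‖ (norm_nonneg s)
    have h4 := mul_le_mul_of_nonneg_left
      (Real.neg_one_le_cos (α * (v.arg + Real.pi / 2))) hn
    have h5 := mul_le_mul_of_nonneg_left (Real.cos_le_one (α * (ω₀ + Real.pi / 2))) hn
    have := le_max_right b (2 * C)
    linarith

/-- The vertical line through the saddle point is a path of descent: there `Re (s ^ α)` is at least
`(Re s) ^ α`. -/
theorem saddlePhase_re_le_neg_stableDelta {α : ℝ} (hα₀ : 0 < α) (hα₁ : α < 1) {s : ℂ}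
    (hs : 0 ≤ s.im) (hre : s.re = saddlePoint α) : (saddlePhase α s).re ≤ -stableDelta α := by
  set v := -Complex.I * s with hv
  have hvre : 0 ≤ v.re := by simpa [hv] using hs
  have hvn : ‖v‖ = ‖s‖ := by simp [hv]
  have hsre : s.re = ‖s‖ * Real.cos (v.arg + Real.pi / 2) := by
    rw [Real.cos_add_pi_div_two, mul_neg, ← hvn, Complex.norm_mul_sin_arg]; simp [hv]
  have hpos : 0 < s.re := hre ▸ saddlePoint_pos hα₀
  have harg := abs_le.1 (Complex.abs_arg_le_pi_div_two_iff.2 hvre)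
  have hargneg : v.arg ≤ 0 := by
    have : v.im < 0 := by simpa [hv] using hpos
    exact (Complex.arg_neg_iff.2 this).le
  have h1 := cos_rpow_le_cos_mul hα₀.le hα₁.le (φ := v.arg + Real.pi / 2) (by linarith)
    (by linarith)
  have h2 : 0 ≤ Real.cos (v.arg + Real.pi / 2) :=
    Real.cos_nonneg_of_neg_pi_div_two_le_of_le (by linarith) (by linarith)
  have h3 := mul_le_mul_of_nonneg_left h1 (by positivity : 0 ≤ ‖s‖ ^ α)
  rw [← Real.mul_rpow (norm_nonneg _) h2, ← hsre, hre] at h3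
  rw [saddlePhase_re, ← hv, stableDelta_eq hα₀ hα₁, hre]
  linarith

theorem tendsto_mul_exp_neg_rpow {α c : ℝ} (hα₀ : 0 < α) (hc : 0 < c) :
    Tendsto (fun T : ℝ => T * Real.exp (-c * T ^ α)) atTop (𝓝 0) := by
  have h := (tendsto_rpow_mul_exp_neg_mul_atTop_nhds_zero (1 / α) c hc).comp
    (tendsto_rpow_atTop hα₀)
  refine h.congr' ?_
  filter_upwards [eventually_ge_atTop 0] with T hT
  simp only [Function.comp]
  rw [← Real.rpow_mul hT, mul_one_div_cancel hα₀.ne', Real.rpow_one]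

/-- Cauchy's theorem on the rectangle with corners `-T` and `s₀ + iT`, `s₀` the saddle point. The
segment `[0, s₀]` contributes a real number, and the top and left edges vanish as `T → ∞`, so the
imaginary part of the integral over the negative axis is that of the integral over the vertical
line through `s₀`. -/
theorem exists_abs_im_integral_Ioi_saddlePhase_le {α : ℝ} (hα₀ : 0 < α) (hα₁ : α < 1) :
    ∃ K : ℝ, ∀ x : ℝ, 1 ≤ x →
      |(∫ t in Set.Ioi (0 : ℝ), Complex.exp (x * saddlePhase α (-t : ℝ))).im| ≤
        Real.exp (-(stableDelta α * x)) * K := by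
  have hs₀ := saddlePoint_pos hα₀
  set s₀ := saddlePoint α with hs₀def
  obtain ⟨C, c, hc, hb⟩ := exists_saddlePhase_re_le hα₀ hα₁ s₀
  have hint : IntegrableOn (fun y : ℝ => Real.exp (stableDelta α + C) * Real.exp (-c * y ^ α))
      (Set.Ioi 0) := by
    have := integrableOn_rpow_mul_exp_neg_mul_rpow (s := 0) (by norm_num) hα₀ hc
    simp only [Real.rpow_zero, one_mul] at this
    exact this.const_mul _
  refine ⟨∫ y in Set.Ioi (0 : ℝ), Real.exp (stableDelta α + C) * Real.exp (-c * y ^ α),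
    fun x hx => ?_⟩
  set K := ∫ y in Set.Ioi (0 : ℝ), Real.exp (stableDelta α + C) * Real.exp (-c * y ^ α)
  have hx0 : 0 < x := by linarith
  set f : ℂ → ℂ := fun s => Complex.exp (x * saddlePhase α s) with hf
  have hfc : ContinuousOn f {s | 0 ≤ s.im} :=
    ((continuousOn_saddlePhase hα₀).const_mul _).cexp
  have hfn : ∀ s, ‖f s‖ = Real.exp (x * (saddlePhase α s).re) := fun s => by
    rw [hf, Complex.norm_exp, Complex.re_ofReal_mul]
  have hfb : ∀ s : ℂ, 0 ≤ s.im → s.re ≤ s₀ → ‖f s‖ ≤ Real.exp (x * (C - c * ‖s‖ ^ α)) := by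
    intro s h1 h2
    rw [hfn, Real.exp_le_exp]
    gcongr
    exact hb s h1 h2
  have hbot_cont : Continuous fun t : ℝ => f (t : ℂ) := by
    refine hfc.comp_continuous (by fun_prop) fun t => ?_
    simp
  have hbot_int : IntegrableOn (fun t : ℝ => f ((-t : ℝ) : ℂ)) (Set.Ioi 0) := by
    have := integrableOn_rpow_mul_exp_neg_mul_rpow (s := 0) (by norm_num) hα₀ (mul_pos hx0 hc)
    simp only [Real.rpow_zero, one_mul] at this
    refine (this.const_mul (Real.exp (x * C))).mono'
      (hbot_cont.comp continuous_neg).aestronglyMeasurable ?_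
    refine (ae_restrict_iff' measurableSet_Ioi).2 (Eventually.of_forall fun t ht => ?_)
    have ht : 0 ≤ t := le_of_lt ht
    refine (hfb _ (by simp) (by simp; linarith)).trans (le_of_eq ?_)
    rw [← Real.exp_add, Complex.norm_real, Real.norm_eq_abs, abs_neg, abs_of_nonneg ht]
    ring_nf
  -- the error terms from the top and left edges of the rectangle
  set E : ℝ → ℝ := fun T => Real.exp (x * (C - c * T ^ α)) * (s₀ + T) +
    Real.exp (x * (C - c * T ^ α)) * T with hE
  have hE0 : Tendsto E atTop (𝓝 0) := by
    have h1 := tendsto_mul_exp_neg_rpow hα₀ (mul_pos hx0 hc)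
    have h2 : Tendsto (fun T : ℝ => Real.exp (-(x * c) * T ^ α)) atTop (𝓝 0) := by
      refine Real.tendsto_exp_atBot.comp ?_
      exact (tendsto_rpow_atTop hα₀).const_mul_atTop_of_neg (by nlinarith)
    have h3 := ((h2.const_mul (Real.exp (x * C) * s₀)).add (h1.const_mul (2 * Real.exp (x * C))))
    simp only [mul_zero, add_zero] at h3
    refine h3.congr fun T => ?_
    have : Real.exp (x * (C - c * T ^ α)) = Real.exp (x * C) * Real.exp (-(x * c) * T ^ α) := by
      rw [← Real.exp_add]; ring_nf
    rw [hE]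
    simp only [this]
    ring
  have hmain : ∀ T : ℝ, 0 ≤ T → |(∫ t in (0 : ℝ)..T, f (-t : ℝ)).im| ≤
      Real.exp (-(stableDelta α * x)) * K + E T := by
    intro T hT
    have hrect := Complex.integral_boundary_rect_eq_zero_of_continuousOn_of_differentiableOn f
      (⟨-T, 0⟩ : ℂ) (⟨s₀, T⟩ : ℂ) ?_ ?_
    · simp only [Complex.ofReal_zero, zero_mul, add_zero] at hrect
      have hsplit : ∫ u in (-T)..s₀, f (u : ℂ) =
          (∫ t in (0 : ℝ)..T, f (-t : ℝ)) + ∫ u in (0 : ℝ)..s₀, f (u : ℂ) := by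
        rw [intervalIntegral.integral_comp_neg (fun u : ℝ => f (u : ℂ)), neg_zero,
          intervalIntegral.integral_add_adjacent_intervals]
        · exact hbot_cont.intervalIntegrable _ _
        · exact hbot_cont.intervalIntegrable _ _
      have hreal : (∫ u in (0 : ℝ)..s₀, f (u : ℂ)).im = 0 := by
        have : ∫ u in (0 : ℝ)..s₀, f (u : ℂ) =
            ∫ u in (0 : ℝ)..s₀, ((Real.exp (x * (u - u ^ α)) : ℝ) : ℂ) := by
          refine intervalIntegral.integral_congr fun u hu => ?_
          rw [Set.uIcc_of_le hs₀.le] at hu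
          simp only [hf]
          rw [saddlePhase_ofReal hα₀ hu.1]
          push_cast
          rfl
        rw [this, intervalIntegral.integral_ofReal, Complex.ofReal_im]
      have htop : ‖∫ u in (-T)..s₀, f (u + T * Complex.I)‖ ≤
          Real.exp (x * (C - c * T ^ α)) * (s₀ + T) := by
        have := intervalIntegral.norm_integral_le_of_norm_le_const (a := -T) (b := s₀)
          (f := fun u : ℝ => f (u + T * Complex.I)) (C := Real.exp (x * (C - c * T ^ α))) ?_
        · rwa [abs_of_nonneg (by linarith), sub_neg_eq_add] at this
        · intro u hu
          rw [Set.uIoc_of_le (by linarith)] at hu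
          refine (hfb _ (by simpa using hT) (by simpa using hu.2)).trans ?_
          gcongr
          have := Complex.abs_im_le_norm (u + T * Complex.I)
          simp only [Complex.add_im, Complex.ofReal_im, Complex.mul_im, Complex.ofReal_re,
            Complex.I_im, Complex.I_re, mul_zero, mul_one, add_zero, zero_add] at this
          exact (le_abs_self T).trans this
      have hleft : ‖∫ y in (0 : ℝ)..T, f ((-T : ℝ) + y * Complex.I)‖ ≤
          Real.exp (x * (C - c * T ^ α)) * T := by
        have := intervalIntegral.norm_integral_le_of_norm_le_const (a := 0) (b := T)
          (f := fun y : ℝ => f ((-T : ℝ) + y * Complex.I))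
          (C := Real.exp (x * (C - c * T ^ α))) ?_
        · rwa [sub_zero, abs_of_nonneg hT] at this
        · intro y hy
          rw [Set.uIoc_of_le hT] at hy
          refine (hfb _ (by simpa using hy.1.le) (by simp; linarith)).trans ?_
          gcongr
          have := Complex.abs_re_le_norm ((-T : ℝ) + y * Complex.I)
          simp only [Complex.add_re, Complex.ofReal_im, Complex.mul_re, Complex.ofReal_re,
            Complex.I_im, Complex.I_re, mul_zero, mul_one, add_zero, sub_self, abs_neg] at this
          exact (le_abs_self T).trans this
      have hright : ‖∫ y in (0 : ℝ)..T, f (s₀ + y * Complex.I)‖ ≤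
          Real.exp (-(stableDelta α * x)) * K := by
        rw [intervalIntegral.integral_of_le hT]
        calc _ ≤ ∫ y in Set.Ioc 0 T, Real.exp (-(stableDelta α * x)) *
              (Real.exp (stableDelta α + C) * Real.exp (-c * y ^ α)) := by
              refine norm_integral_le_of_norm_le
                ((hint.mono_set Set.Ioc_subset_Ioi_self).const_mul _) ?_
              refine (ae_restrict_iff' measurableSet_Ioc).2
                (Eventually.of_forall fun y hy => ?_)
              have h1 := saddlePhase_re_le_neg_stableDelta hα₀ hα₁ (s := s₀ + y * Complex.I)
                (by simpa using hy.1.le) (by simp [hs₀def])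
              have h2 := hb (s₀ + y * Complex.I) (by simpa using hy.1.le) (by simp)
              have h3 : y ^ α ≤ ‖(s₀ + y * Complex.I : ℂ)‖ ^ α := by
                have hy0 := hy.1.le
                gcongr
                have := Complex.abs_im_le_norm (s₀ + y * Complex.I)
                simp only [Complex.add_im, Complex.ofReal_im, Complex.mul_im, Complex.ofReal_re,
                  Complex.I_im, Complex.I_re, mul_zero, mul_one, add_zero, zero_add] at this
                exact (le_abs_self y).trans this
              have h4 := mul_le_mul_of_nonneg_left h3 hc.le
              -- for `x ≥ 1`, one copy of the phase is kept for integrability, the others give `-δ`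
              have h5 : 0 ≤ (x - 1) *
                  (-(saddlePhase α (s₀ + y * Complex.I)).re - stableDelta α) :=
                mul_nonneg (by linarith) (by linarith)
              rw [hfn, ← Real.exp_add, ← Real.exp_add, Real.exp_le_exp]
              nlinarith
          _ ≤ _ := by
              rw [integral_const_mul]
              refine mul_le_mul_of_nonneg_left ?_ (Real.exp_pos _).le
              refine setIntegral_mono_set hint (Eventually.of_forall fun y => by positivity)
                (Eventually.of_forall Set.Ioc_subset_Ioi_self)
      rw [hsplit] at hrect
      have him := congrArg Complex.im hrect
      have h1 := (Complex.abs_im_le_norm _).trans htop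
      have h2 := (Complex.abs_re_le_norm _).trans hleft
      have h3 := (Complex.abs_re_le_norm _).trans hright
      simp only [smul_eq_mul, Complex.add_im, Complex.sub_im, Complex.I_mul_im, hreal, add_zero,
        Complex.zero_im] at him
      have h4 : (∫ t in (0 : ℝ)..T, f (-t : ℝ)).im =
          (∫ u in (-T)..s₀, f (u + T * Complex.I)).im -
          (∫ y in (0 : ℝ)..T, f (s₀ + y * Complex.I)).re +
          (∫ y in (0 : ℝ)..T, f ((-T : ℝ) + y * Complex.I)).re := by linarith
      rw [h4, hE]
      refine (abs_add_le _ _).trans ?_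
      have := abs_sub (∫ u in (-T)..s₀, f (u + T * Complex.I)).im
        (∫ y in (0 : ℝ)..T, f (s₀ + y * Complex.I)).re
      simp only
      linarith
    · refine hfc.mono fun s hs => ?_
      have := hs.2
      rw [Set.mem_preimage, Set.uIcc_of_le hT] at this
      exact this.1
    · intro s hs
      have h := hs.2
      rw [Set.mem_preimage] at h
      simp only [min_eq_left hT] at h
      have := (((differentiableAt_saddlePhase α h.1).const_mul (x : ℂ)).cexp)
      exact this.differentiableWithinAt
  -- let `T → ∞`
  have hlim := intervalIntegral_tendsto_integral_Ioi 0 hbot_int tendsto_id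
  have hlim2 := ((Complex.continuous_im.tendsto _).comp hlim).abs
  have hlim3 := (hE0.const_add (Real.exp (-(stableDelta α * x)) * K))
  rw [add_zero] at hlim3
  refine le_of_tendsto_of_tendsto hlim2 hlim3 ?_
  filter_upwards [eventually_ge_atTop 0] with T hT using hmain T hT

theorem exists_norm_stableJump_real_le {α : ℝ} (hα₀ : 0 < α) (hα₁ : α < 1) :
    ∃ A : ℝ, ∀ ζ : ℂ, ζ.im = 0 → 0 ≤ ζ.re → ‖stableJump α ζ‖ ≤ A * Real.exp ζ.re := by
  obtain ⟨K, hK⟩ := exists_abs_im_integral_Ioi_saddlePhase_le hα₀ hα₁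
  refine ⟨2 * K, fun ζ hζ h0 => ?_⟩
  obtain ⟨ξ, rfl⟩ : ∃ ξ : ℝ, ζ = ξ := ⟨ζ.re, Complex.ext rfl (by simpa using hζ)⟩
  rw [Complex.ofReal_re] at h0 ⊢
  have hx : 1 ≤ Real.exp ξ := Real.one_le_exp h0
  have h1 : stableBranch α (ξ - Real.pi * Complex.I) = (Real.exp ξ : ℝ) *
      ∫ t in Set.Ioi (0 : ℝ), Complex.exp ((Real.exp ξ : ℝ) * saddlePhase α (-t : ℝ)) := by
    rw [stableBranch_eq_rotate hα₀ hα₁ (η := ξ) (by simp [Real.pi_pos]), Complex.ofReal_exp]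
    congr 1
    refine setIntegral_congr_fun measurableSet_Ioi fun t ht => ?_
    have ht : 0 ≤ t := le_of_lt ht
    rw [saddlePhase_neg_ofReal hα₀ ht,
      show (α * ξ + (1 - α) * (ξ - Real.pi * Complex.I) : ℂ) =
        ξ + Real.pi * α * Complex.I - Real.pi * Complex.I by ring,
      Complex.exp_sub_pi_mul_I, Complex.exp_add (ξ : ℂ) (Real.pi * α * Complex.I)]
    congr 1
    ring
  have h2 : stableBranch α (ξ + Real.pi * Complex.I) =
      starRingEnd ℂ (stableBranch α (ξ - Real.pi * Complex.I)) := by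
    rw [← stableBranch_conj]; simp [sub_eq_add_neg]
  have h3 := hK _ hx
  set J := ∫ t in Set.Ioi (0 : ℝ), Complex.exp ((Real.exp ξ : ℝ) * saddlePhase α (-t : ℝ))
  have h4 : ‖stableBranch α (ξ + Real.pi * Complex.I) -
      stableBranch α (ξ - Real.pi * Complex.I)‖ = 2 * Real.exp ξ * |J.im| := by
    rw [h2, norm_sub_rev, Complex.sub_conj, norm_mul, Complex.norm_I, mul_one,
      Complex.norm_real, h1, Complex.im_ofReal_mul, Real.norm_eq_abs, abs_mul, abs_mul,
      Real.abs_exp, abs_two]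
    ring
  unfold stableJump
  rw [norm_mul, h4, ← Complex.ofReal_exp, ← Complex.ofReal_mul, ← Complex.ofReal_exp,
    Complex.norm_real, Real.norm_eq_abs, Real.abs_exp]
  calc _ ≤ Real.exp (stableDelta α * Real.exp ξ) * (2 * Real.exp ξ *
        (Real.exp (-(stableDelta α * Real.exp ξ)) * K)) := by gcongr
    _ = (Real.exp (stableDelta α * Real.exp ξ) * Real.exp (-(stableDelta α * Real.exp ξ))) *
        (2 * K * Real.exp ξ) := by ring
    _ = _ := by rw [← Real.exp_add, add_neg_cancel, Real.exp_zero, one_mul]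

/-! ### Laplace's method on the positive axis -/

theorem integrable_exp_neg_mul_abs {k : ℝ} (hk : 0 < k) :
    Integrable fun v : ℝ => Real.exp (-k * |v|) := by
  rw [← integrableOn_univ, ← Set.Iic_union_Ioi (a := (0 : ℝ))]
  refine IntegrableOn.union ?_ ?_
  · refine (integrableOn_exp_mul_Iic hk 0).congr_fun (fun v hv => ?_) measurableSet_Iic
    simp only
    rw [abs_of_nonpos hv, neg_mul_neg]
  · refine (exp_neg_integrableOn_Ioi 0 hk).congr_fun (fun v hv => ?_) measurableSet_Ioi
    simp only
    rw [abs_of_pos hv]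

/-- Laplace's method for a function on the positive half-line with a quadratic minimum `0`
at `1`. -/
theorem tendsto_sqrt_mul_integral_exp_neg {B : ℝ → ℝ} {k a : ℝ} (hB : Measurable B) (hk : 0 < k)
    (hB1 : B 1 = 0)
    (hlow : ∀ τ, 0 < τ → k * ((τ - 1) ^ 2 / (1 + |τ - 1|)) ≤ B τ)
    (hlim : Tendsto (fun h => B (1 + h) / h ^ 2) (𝓝[≠] 0) (𝓝 a)) :
    Tendsto (fun X : ℝ => √X * ∫ τ in Set.Ioi (0 : ℝ), Real.exp (-(X * B τ))) atTop
      (𝓝 √(Real.pi / a)) := by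
  set g : ℝ → ℝ → ℝ := fun X => (Set.Ioi (0 : ℝ)).indicator fun τ => Real.exp (-(X * B τ)) with hg
  have hgm : ∀ X, Measurable (g X) := fun X =>
    ((hB.const_mul X).neg.exp).indicator measurableSet_Ioi
  have hscale : ∀ X : ℝ, 0 < X → ∫ v, g X (1 + v / √X) =
      √X * ∫ τ in Set.Ioi (0 : ℝ), Real.exp (-(X * B τ)) := by
    intro X hX
    rw [Measure.integral_comp_div (fun v => g X (1 + v)), integral_add_left_eq_self (g X),
      abs_of_nonneg (Real.sqrt_nonneg X), smul_eq_mul, hg, integral_indicator measurableSet_Ioi]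
  have hmain : Tendsto (fun X : ℝ => ∫ v, g X (1 + v / √X)) atTop
      (𝓝 (∫ v : ℝ, Real.exp (-a * v ^ 2))) := by
    refine tendsto_integral_filter_of_dominated_convergence
      (fun v => Real.exp k * Real.exp (-k * |v|)) ?_ ?_
      ((integrable_exp_neg_mul_abs hk).const_mul _) ?_
    · exact Eventually.of_forall fun X =>
        ((hgm X).comp (by fun_prop : Measurable fun v : ℝ => 1 + v / √X)).aestronglyMeasurable
    · filter_upwards [eventually_ge_atTop 1] with X hX
      refine Eventually.of_forall fun v => ?_
      have hs : 1 ≤ √X := Real.one_le_sqrt.2 hX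
      have hs2 : √X ^ 2 = X := Real.sq_sqrt (by linarith)
      simp only [hg]
      by_cases hv : 0 < 1 + v / √X
      · rw [Set.indicator_of_mem (show 1 + v / √X ∈ Set.Ioi 0 from hv), Real.norm_eq_abs,
          Real.abs_exp, ← Real.exp_add, Real.exp_le_exp]
        have h1 := hlow _ hv
        rw [add_sub_cancel_left] at h1
        have h2 : |v / √X| ≤ |v| := by
          rw [abs_div, abs_of_pos (by linarith : 0 < √X)]
          exact div_le_self (abs_nonneg v) hs
        have h3 : |v| - 1 ≤ v ^ 2 / (1 + |v / √X|) := by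
          rw [le_div_iff₀ (by positivity), ← sq_abs v]
          nlinarith [abs_nonneg v, abs_nonneg (v / √X)]
        have h4 : X * ((v / √X) ^ 2 / (1 + |v / √X|)) = v ^ 2 / (1 + |v / √X|) := by
          rw [div_pow, hs2]; field_simp
        have h5 := mul_le_mul_of_nonneg_left h1 (by linarith : 0 ≤ X)
        rw [mul_left_comm, h4] at h5
        nlinarith
      · rw [Set.indicator_of_notMem (by simpa using hv), norm_zero]
        positivity
    · refine Eventually.of_forall fun v => ?_
      have hu : Tendsto (fun X : ℝ => v / √X) atTop (𝓝 0) :=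
        tendsto_const_nhds.div_atTop (Real.tendsto_sqrt_atTop)
      have hpos : ∀ᶠ X : ℝ in atTop, 0 < 1 + v / √X := by
        have := hu.const_add 1
        rw [add_zero] at this
        exact this.eventually (lt_mem_nhds one_pos)
      have hexp : Tendsto (fun X : ℝ => X * B (1 + v / √X)) atTop (𝓝 (a * v ^ 2)) := by
        rcases eq_or_ne v 0 with rfl | hv
        · simp [hB1]
        · have h1 : Tendsto (fun X : ℝ => v / √X) atTop (𝓝[≠] 0) := by
            refine tendsto_nhdsWithin_iff.2 ⟨hu, ?_⟩
            filter_upwards [eventually_gt_atTop 0] with X hX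
            exact div_ne_zero hv (Real.sqrt_pos.2 hX).ne'
          refine ((hlim.comp h1).mul_const (v ^ 2)).congr' ?_
          filter_upwards [eventually_gt_atTop 0] with X hX
          have := Real.sq_sqrt hX.le
          have h0 := (Real.sqrt_pos.2 hX).ne'
          simp only [Function.comp]
          rw [div_pow, this]
          field_simp
      have := (Real.continuous_exp.tendsto _).comp hexp.neg
      rw [← neg_mul] at this
      refine this.congr' ?_
      filter_upwards [hpos] with X hX
      simp only [hg, Function.comp]
      rw [Set.indicator_of_mem (show 1 + v / √X ∈ Set.Ioi 0 from hX)]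
  rw [integral_gaussian] at hmain
  refine hmain.congr' ?_
  filter_upwards [eventually_gt_atTop 0] with X hX using hscale X hX

/-- The defect `1 - α + α τ - τ ^ α` in Bernoulli's inequality. After the substitution
`t = s₀ τ`, `s₀` the saddle point, `t ^ α - t` is `δ - (s₀ / α)` times this defect. -/
noncomputable def bernoulliDefect (α τ : ℝ) : ℝ := 1 - α + α * τ - τ ^ α

/-- Quantitative Bernoulli inequality. With `τ = r ^ 2`, it follows from Bernoulli's inequality for
`r ^ (2 α)` or, when `2 α > 1`, for `r ^ (2 α - 1)`. -/
theorem bernoulliDefect_ge_sqrt {α τ : ℝ} (hα₀ : 0 < α) (hα₁ : α < 1) (hτ : 0 < τ) :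
    min α (1 - α) * (√τ - 1) ^ 2 ≤ bernoulliDefect α τ := by
  set r := √τ with hr
  have hr0 : 0 < r := Real.sqrt_pos.2 hτ
  have hτr : τ = r ^ 2 := (Real.sq_sqrt hτ.le).symm
  have hpow : τ ^ α = r ^ (2 * α) := by
    rw [hτr, ← Real.rpow_natCast, ← Real.rpow_mul hr0.le]; norm_num
  have hsq : 0 ≤ (r - 1) ^ 2 := sq_nonneg _
  unfold bernoulliDefect
  rw [hpow, hτr]
  rcases le_total (2 * α) 1 with h | h
  · have h1 := rpow_one_add_le_one_add_mul_self (s := r - 1) (by linarith) (p := 2 * α)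
      (by linarith) h
    rw [add_sub_cancel] at h1
    have h2 := mul_le_mul_of_nonneg_right (min_le_left α (1 - α)) hsq
    nlinarith
  · have h1 := rpow_one_add_le_one_add_mul_self (s := r - 1) (by linarith) (p := 2 * α - 1)
      (by linarith) (by linarith)
    rw [add_sub_cancel] at h1
    have h2 := mul_le_mul_of_nonneg_right (min_le_right α (1 - α)) hsq
    have h3 : r ^ (2 * α) = r * r ^ (2 * α - 1) := by
      rw [Real.rpow_sub_one hr0.ne']; field_simp
    rw [h3]
    have h4 := mul_le_mul_of_nonneg_left h1 hr0.le
    nlinarith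

theorem bernoulliDefect_ge {α τ : ℝ} (hα₀ : 0 < α) (hα₁ : α < 1) (hτ : 0 < τ) :
    min α (1 - α) / 4 * ((τ - 1) ^ 2 / (1 + |τ - 1|)) ≤ bernoulliDefect α τ := by
  refine le_trans ?_ (bernoulliDefect_ge_sqrt hα₀ hα₁ hτ)
  have hm : 0 < min α (1 - α) := lt_min hα₀ (sub_pos.2 hα₁)
  have h1 : (τ - 1) ^ 2 = (√τ - 1) ^ 2 * (√τ + 1) ^ 2 := by
    rw [← mul_pow]
    congr 1
    nlinarith [Real.sq_sqrt hτ.le]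
  have h2 : (√τ + 1) ^ 2 ≤ 4 * (1 + |τ - 1|) := by
    nlinarith [Real.sq_sqrt hτ.le, sq_nonneg (√τ - 1), le_abs_self (τ - 1), abs_nonneg (τ - 1)]
  rw [div_mul_eq_mul_div, mul_div_assoc]
  refine mul_le_mul_of_nonneg_left ?_ hm.le
  rw [div_le_iff₀ (by norm_num), div_le_iff₀ (by positivity), h1]
  have := mul_le_mul_of_nonneg_left h2 (sq_nonneg (√τ - 1))
  linarith

theorem tendsto_bernoulliDefect_div_sq (α : ℝ) :
    Tendsto (fun h => bernoulliDefect α (1 + h) / h ^ 2) (𝓝[≠] 0) (𝓝 (α * (1 - α) / 2)) := by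
  have hpow : ∀ β : ℝ, ∀ h : ℝ, -1 < h →
      HasDerivAt (fun h : ℝ => (1 + h) ^ β) (β * (1 + h) ^ (β - 1)) h := by
    intro β h hh
    have := ((hasDerivAt_id h).const_add 1).rpow_const (p := β) (Or.inl (by simp; linarith))
    simpa using this
  have hev : ∀ᶠ h : ℝ in 𝓝[≠] 0, -1 < h :=
    nhdsWithin_le_nhds (lt_mem_nhds (by norm_num))
  have hderiv : ∀ h : ℝ, -1 < h → HasDerivAt (fun h => bernoulliDefect α (1 + h))
      (α - α * (1 + h) ^ (α - 1)) h := by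
    intro h hh
    have := ((((hasDerivAt_id h).const_add 1).const_mul α).const_add (1 - α)).sub (hpow α h hh)
    rw [mul_one] at this
    exact this
  refine HasDerivAt.lhopital_zero_nhdsNE (f' := fun h => α - α * (1 + h) ^ (α - 1))
    (g' := fun h => 2 * h) ?_ ?_ ?_ ?_ ?_ ?_
  · filter_upwards [hev] with h hh using hderiv h hh
  · exact Eventually.of_forall fun h => by simpa using hasDerivAt_pow 2 h
  · filter_upwards [self_mem_nhdsWithin] with h hh
    exact mul_ne_zero two_ne_zero hh
  · have := (hderiv 0 (by norm_num)).continuousAt.tendsto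
    have h0 : bernoulliDefect α (1 + 0) = 0 := by simp [bernoulliDefect]
    rw [h0] at this
    exact this.mono_left nhdsWithin_le_nhds
  · have : Continuous fun h : ℝ => h ^ 2 := by fun_prop
    exact (this.tendsto' 0 0 (by norm_num)).mono_left nhdsWithin_le_nhds
  · have h1 := (hasDerivAt_iff_tendsto_slope.1 (hpow (α - 1) 0 (by norm_num))).const_mul (-α / 2)
    simp only [add_zero, Real.one_rpow, mul_one] at h1
    rw [show -α / 2 * (α - 1) = α * (1 - α) / 2 by ring] at h1
    refine h1.congr' ?_
    filter_upwards [self_mem_nhdsWithin] with h hh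
    have hh : h ≠ 0 := hh
    simp only [slope, vsub_eq_sub, sub_zero, smul_eq_mul, add_zero, Real.one_rpow]
    field_simp
    ring

theorem stableC_eq {α : ℝ} (hα₀ : 0 < α) (hα₁ : α < 1) :
    2 * Real.pi * stableC α = saddlePoint α * √(α / saddlePoint α) *
      √(Real.pi / (α * (1 - α) / 2)) := by
  have h1 : 0 < 1 - α := sub_pos.2 hα₁
  have hs := saddlePoint_pos hα₀
  have hp := Real.pi_pos
  have hsq : α ^ (1 / (2 * (1 - α))) = √(saddlePoint α) := by
    rw [Real.sqrt_eq_rpow, saddlePoint, ← Real.rpow_mul hα₀.le]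
    congr 1
    field_simp
  have hc : stableC α = (√(2 * Real.pi * (1 - α)))⁻¹ * √(saddlePoint α) := by
    rw [stableC, hsq, Real.rpow_neg (by positivity), ← Real.sqrt_eq_rpow]
  have hL : 0 ≤ 2 * Real.pi * stableC α := by rw [hc]; positivity
  refine (sq_eq_sq₀ hL (by positivity)).1 ?_
  rw [hc, mul_pow, mul_pow, mul_pow, mul_pow, mul_pow, inv_pow, Real.sq_sqrt (by positivity),
    Real.sq_sqrt hs.le, Real.sq_sqrt (by positivity), Real.sq_sqrt (by positivity)]
  field_simp

theorem stableBranch_ofReal {α : ℝ} (hα₀ : 0 < α) (hα₁ : α < 1) (ξ : ℝ) :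
    stableBranch α ξ = ((Real.exp ξ * (saddlePoint α *
      (Real.exp (stableDelta α * Real.exp ξ) * ∫ τ in Set.Ioi (0 : ℝ),
        Real.exp (-(Real.exp ξ * saddlePoint α / α * bernoulliDefect α τ)))) : ℝ) : ℂ) := by
  have hs := saddlePoint_pos hα₀
  have h1 : ∫ τ in Set.Ioi (0 : ℝ), Real.exp (Real.exp ξ * ((saddlePoint α * τ) ^ α -
      saddlePoint α * τ)) = Real.exp (stableDelta α * Real.exp ξ) * ∫ τ in Set.Ioi (0 : ℝ),
        Real.exp (-(Real.exp ξ * saddlePoint α / α * bernoulliDefect α τ)) := by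
    rw [← integral_const_mul]
    refine setIntegral_congr_fun measurableSet_Ioi fun τ hτ => ?_
    have hτ : 0 ≤ τ := le_of_lt hτ
    rw [← Real.exp_add, Real.mul_rpow hs.le hτ, saddlePoint_rpow hα₀ hα₁, stableDelta_eq hα₀ hα₁,
      saddlePoint_rpow hα₀ hα₁, bernoulliDefect]
    congr 1
    field_simp
    ring
  have h2 := integral_comp_mul_left_Ioi (fun t : ℝ => Real.exp (Real.exp ξ * (t ^ α - t))) 0 hs
  rw [h1, mul_zero, smul_eq_mul, eq_inv_mul_iff_mul_eq₀ hs.ne'] at h2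
  rw [stableBranch_eq_rotate hα₀ hα₁ (η := ξ) (by simp [Real.pi_pos]), h2, Complex.ofReal_mul,
    ← integral_complex_ofReal, Complex.ofReal_exp]
  congr 1
  refine setIntegral_congr_fun measurableSet_Ioi fun t ht => ?_
  rw [show (α * ξ + (1 - α) * ξ : ℂ) = ξ by ring]
  push_cast
  ring_nf

theorem tendsto_stableBranch_ofReal {α : ℝ} (hα₀ : 0 < α) (hα₁ : α < 1) :
    Tendsto (fun ξ : ℝ => stableBranch α ξ * Complex.exp (-(stableDelta α * Complex.exp ξ)) *
      Complex.exp (-(ξ / 2))) atTop (𝓝 (2 * Real.pi * stableC α)) := by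
  have hs := saddlePoint_pos hα₀
  have h1 := tendsto_sqrt_mul_integral_exp_neg (B := bernoulliDefect α)
    (k := min α (1 - α) / 4) (a := α * (1 - α) / 2)
    (by unfold bernoulliDefect; fun_prop)
    (by have := lt_min hα₀ (sub_pos.2 hα₁); positivity)
    (by simp [bernoulliDefect]) (fun τ hτ => bernoulliDefect_ge hα₀ hα₁ hτ)
    (tendsto_bernoulliDefect_div_sq α)
  have h2 : Tendsto (fun ξ : ℝ => Real.exp ξ * saddlePoint α / α) atTop atTop :=
    (Real.tendsto_exp_atTop.atTop_mul_const hs).atTop_div_const hα₀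
  have h3 := ((h1.comp h2).const_mul (saddlePoint α * √(α / saddlePoint α)))
  rw [← stableC_eq hα₀ hα₁] at h3
  have h4 := (Complex.continuous_ofReal.tendsto _).comp h3
  push_cast at h4
  refine h4.congr fun ξ => ?_
  rw [stableBranch_ofReal hα₀ hα₁]
  set J := ∫ τ in Set.Ioi (0 : ℝ),
    Real.exp (-(Real.exp ξ * saddlePoint α / α * bernoulliDefect α τ))
  simp only [Function.comp]
  rw [show Complex.exp (-(stableDelta α * Complex.exp ξ)) =
      ((Real.exp (-(stableDelta α * Real.exp ξ)) : ℝ) : ℂ) by push_cast; rfl,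
    show Complex.exp (-(ξ / 2)) = ((Real.exp (-(ξ / 2)) : ℝ) : ℂ) by push_cast; rfl,
    ← Complex.ofReal_mul, ← Complex.ofReal_mul, Complex.ofReal_inj]
  have e1 : √(Real.exp ξ * saddlePoint α / α) = Real.exp (ξ / 2) * √(saddlePoint α / α) := by
    rw [mul_div_assoc, Real.sqrt_mul (Real.exp_pos _).le, Real.exp_half]
  have e2 : √(α / saddlePoint α) * √(saddlePoint α / α) = 1 := by
    rw [← Real.sqrt_mul (by positivity)]
    rw [div_mul_div_cancel₀ hs.ne', div_self hα₀.ne', Real.sqrt_one]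
  have e3 : Real.exp ξ * Real.exp (-(ξ / 2)) = Real.exp (ξ / 2) := by
    rw [← Real.exp_add]; ring_nf
  have e4 : Real.exp (stableDelta α * Real.exp ξ) *
      Real.exp (-(stableDelta α * Real.exp ξ)) = 1 := by
    rw [← Real.exp_add, add_neg_cancel, Real.exp_zero]
  rw [e1]
  calc _ = saddlePoint α * Real.exp (ξ / 2) * J *
        (√(α / saddlePoint α) * √(saddlePoint α / α)) := by
        ring
    _ = saddlePoint α * (Real.exp ξ * Real.exp (-(ξ / 2))) * J *
        (Real.exp (stableDelta α * Real.exp ξ) * Real.exp (-(stableDelta α * Real.exp ξ))) := by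
        rw [e2, e3, e4]
    _ = _ := by ring

/-! ### Phragmén–Lindelöf estimates -/

theorem stableC_pos {α : ℝ} (hα₀ : 0 < α) (hα₁ : α < 1) : 0 < stableC α := by
  have h1 : 0 < 1 - α := sub_pos.2 hα₁
  have hp := Real.pi_pos
  unfold stableC
  positivity

/-- The difference between `T(ζ)` and its expected asymptotic form `2πi c e^{ζ / 2}`. -/
noncomputable def stableRemainder (α : ℝ) (ζ : ℂ) : ℂ :=
  stableJump α ζ - 2 * Real.pi * Complex.I * stableC α * Complex.exp (ζ / 2)

theorem differentiable_stableRemainder {α : ℝ} (hα₀ : 0 < α) (hα₁ : α < 1) :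
    Differentiable ℂ (stableRemainder α) :=
  (differentiable_stableJump hα₀ hα₁).sub (by fun_prop)

theorem norm_stableRemainder_conj (α : ℝ) (ζ : ℂ) :
    ‖stableRemainder α (starRingEnd ℂ ζ)‖ = ‖stableRemainder α ζ‖ := by
  have h1 : starRingEnd ℂ (2 * Real.pi * Complex.I * stableC α * Complex.exp (ζ / 2)) =
      -(2 * Real.pi * Complex.I * stableC α * Complex.exp (starRingEnd ℂ ζ / 2)) := by
    have h2 : starRingEnd ℂ 2 = 2 := map_ofNat _ 2
    rw [map_mul, ← Complex.exp_conj, map_div₀]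
    simp [h2]
  have h : stableRemainder α (starRingEnd ℂ ζ) = -starRingEnd ℂ (stableRemainder α ζ) := by
    rw [stableRemainder, stableRemainder, map_sub, h1, stableJump_conj]
    ring
  rw [h, norm_neg, RCLike.norm_conj]

theorem norm_stableJump_le {α : ℝ} (hα₀ : 0 < α) (hα₁ : α < 1) (ζ : ℂ) :
    ‖stableJump α ζ‖ ≤ ‖stableRemainder α ζ‖ + 2 * Real.pi * stableC α * Real.exp (ζ.re / 2) := by
  have h : stableJump α ζ =
      stableRemainder α ζ + 2 * Real.pi * Complex.I * stableC α * Complex.exp (ζ / 2) := by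
    unfold stableRemainder; ring
  rw [h]
  refine (norm_add_le _ _).trans (le_of_eq ?_)
  simp only [norm_mul, Complex.norm_exp, Complex.norm_real, Complex.norm_I, Real.norm_eq_abs,
    abs_of_pos Real.pi_pos, abs_of_pos (stableC_pos hα₀ hα₁)]
  simp

theorem norm_stableRemainder_le {α : ℝ} (hα₀ : 0 < α) (hα₁ : α < 1) (ζ : ℂ) :
    ‖stableRemainder α ζ‖ ≤ ‖stableJump α ζ‖ + 2 * Real.pi * stableC α * Real.exp (ζ.re / 2) := by
  unfold stableRemainder
  refine (norm_sub_le _ _).trans (le_of_eq ?_)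
  simp only [norm_mul, Complex.norm_exp, Complex.norm_real, Complex.norm_I, Real.norm_eq_abs,
    abs_of_pos Real.pi_pos, abs_of_pos (stableC_pos hα₀ hα₁)]
  simp

theorem tendsto_stableRemainder_pi {α : ℝ} (hα₀ : 0 < α) (hα₁ : α < 1) :
    Tendsto (fun ξ : ℝ => stableRemainder α (ξ + Real.pi * Complex.I) * Complex.exp (-(ξ / 2)))
      atTop (𝓝 0) := by
  obtain ⟨κ, hκ, hb⟩ := exists_norm_stableBranch_two_pi_le hα₀ hα₁
  have hδ := stableDelta_pos hα₀ hα₁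
  have h1 : Tendsto (fun ξ : ℝ => stableBranch α (ξ + 2 * Real.pi * Complex.I) *
      Complex.exp (-(stableDelta α * Complex.exp ξ)) * Complex.exp (-(ξ / 2))) atTop (𝓝 0) := by
    have hlim : Tendsto (fun ξ : ℝ => Real.exp (-(ξ / 2)) / (1 - κ)) atTop (𝓝 0) := by
      have : Tendsto (fun ξ : ℝ => Real.exp (-(ξ / 2))) atTop (𝓝 0) :=
        Real.tendsto_exp_neg_atTop_nhds_zero.comp (tendsto_id.atTop_div_const two_pos)
      simpa using this.div_const (1 - κ)
    refine squeeze_zero_norm (fun ξ => ?_) hlim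
    have h2 := hb (ξ + 2 * Real.pi * Complex.I)
      (by simp [abs_of_pos Real.pi_pos])
    have hre : (ξ + 2 * Real.pi * Complex.I : ℂ).re = ξ := by simp
    rw [hre] at h2
    have h3 : 0 < 1 - κ := sub_pos.2 hκ
    have e1 : ‖Complex.exp (-(stableDelta α * Complex.exp ξ))‖ =
        Real.exp (-(stableDelta α * Real.exp ξ)) := by
      rw [Complex.norm_exp, ← Complex.ofReal_exp, ← Complex.ofReal_mul, Complex.neg_re,
        Complex.ofReal_re]
    have e2 : ‖Complex.exp (-(ξ / 2 : ℂ))‖ = Real.exp (-(ξ / 2)) := by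
      rw [Complex.norm_exp]; simp
    rw [norm_mul, norm_mul, e1, e2]
    calc _ ≤ Real.exp (κ * stableDelta α * Real.exp ξ) / (1 - κ) *
          Real.exp (-(stableDelta α * Real.exp ξ)) * Real.exp (-(ξ / 2)) := by gcongr
      _ = Real.exp (-((1 - κ) * stableDelta α * Real.exp ξ)) * (Real.exp (-(ξ / 2)) / (1 - κ)) := by
          rw [show -((1 - κ) * stableDelta α * Real.exp ξ) = κ * stableDelta α * Real.exp ξ +
            -(stableDelta α * Real.exp ξ) by ring, Real.exp_add]
          ring
      _ ≤ 1 * (Real.exp (-(ξ / 2)) / (1 - κ)) := by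
          gcongr
          rw [Real.exp_le_one_iff]
          have := mul_pos (mul_pos h3 hδ) (Real.exp_pos ξ)
          linarith
      _ = _ := one_mul _
  have h2 := (h1.sub (tendsto_stableBranch_ofReal hα₀ hα₁)).add_const (2 * Real.pi * stableC α : ℂ)
  rw [zero_sub, neg_add_cancel] at h2
  refine h2.congr fun ξ => ?_
  have e1 : Complex.exp ((ξ + Real.pi * Complex.I) / 2) = Complex.exp (ξ / 2) * Complex.I := by
    rw [add_div, Complex.exp_add, mul_div_right_comm, Complex.exp_pi_div_two_mul_I]
  have e2 : Complex.exp (ξ / 2 : ℂ) * Complex.exp (-(ξ / 2)) = 1 := by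
    rw [← Complex.exp_add, add_neg_cancel, Complex.exp_zero]
  unfold stableRemainder stableJump
  rw [Complex.exp_add_pi_mul_I, e1, add_sub_cancel_right,
    show (ξ + Real.pi * Complex.I + Real.pi * Complex.I : ℂ) = ξ + 2 * Real.pi * Complex.I by ring,
    mul_neg]
  linear_combination (2 * Real.pi * stableC α : ℂ) * e2 * Complex.I ^ 2 +
    (2 * Real.pi * stableC α : ℂ) * Complex.I_sq

theorem exists_norm_stableRemainder_pi_le {α : ℝ} (hα₀ : 0 < α) (hα₁ : α < 1) {ε : ℝ} (hε : 0 < ε) :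
    ∃ Ξ : ℝ, ∀ ζ : ℂ, |ζ.im| = Real.pi → Ξ ≤ ζ.re →
      ‖stableRemainder α ζ‖ ≤ ε * Real.exp (ζ.re / 2) := by
  have h := (tendsto_stableRemainder_pi hα₀ hα₁).norm.eventually (gt_mem_nhds (by simpa using hε))
  obtain ⟨Ξ, hΞ⟩ := eventually_atTop.1 h
  have hpos : ∀ ζ : ℂ, ζ.im = Real.pi → Ξ ≤ ζ.re →
      ‖stableRemainder α ζ‖ ≤ ε * Real.exp (ζ.re / 2) := by
    intro ζ him hre
    have h1 := (hΞ ζ.re hre).le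
    have h2 : (ζ.re + Real.pi * Complex.I : ℂ) = ζ := by rw [← him, Complex.re_add_im]
    have h3 : ‖Complex.exp (-(ζ.re / 2 : ℂ))‖ = Real.exp (-(ζ.re / 2)) := by
      rw [Complex.norm_exp]; simp
    rw [h2, norm_mul, h3, Real.exp_neg, ← div_eq_mul_inv, div_le_iff₀ (Real.exp_pos _)] at h1
    exact h1
  refine ⟨Ξ, fun ζ him hre => ?_⟩
  rcases (abs_eq Real.pi_pos.le).1 him with h | h
  · exact hpos ζ h hre
  · have := hpos (starRingEnd ℂ ζ) (by simp [h]) (by simpa using hre)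
    rwa [norm_stableRemainder_conj, Complex.conj_re] at this

/-- Phragmén–Lindelöf principle in a horizontal strip, relative to a holomorphic weight `h` bounded
away from zero. -/
theorem norm_le_mul_norm_of_strip {f h : ℂ → ℂ} {a b m K A B c : ℝ} (hf : Differentiable ℂ f)
    (hh : Differentiable ℂ h) (hm : 0 < m)
    (hhm : ∀ ζ : ℂ, a ≤ ζ.im → ζ.im ≤ b → m ≤ ‖h ζ‖) (hc : c < Real.pi / (b - a))
    (hgrowth : ∀ ζ : ℂ, a ≤ ζ.im → ζ.im ≤ b → ‖f ζ‖ ≤ A * Real.exp (B * Real.exp (c * |ζ.re|)))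
    (hab : a ≤ b)
    (ha : ∀ ζ : ℂ, ζ.im = a → ‖f ζ‖ ≤ K * ‖h ζ‖) (hb : ∀ ζ : ℂ, ζ.im = b → ‖f ζ‖ ≤ K * ‖h ζ‖)
    {ζ : ℂ} (hζa : a ≤ ζ.im) (hζb : ζ.im ≤ b) : ‖f ζ‖ ≤ K * ‖h ζ‖ := by
  have hpos : ∀ ζ : ℂ, a ≤ ζ.im → ζ.im ≤ b → 0 < ‖h ζ‖ := fun ζ h1 h2 =>
    hm.trans_le (hhm ζ h1 h2)
  have key : ‖f ζ / h ζ‖ ≤ K := by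
    refine PhragmenLindelof.horizontal_strip (f := fun ζ => f ζ / h ζ) (a := a) (b := b) ?_
      ⟨c, hc, B, ?_⟩ ?_ ?_ hζa hζb
    · refine DifferentiableOn.diffContOnCl fun w hw => ?_
      have hcl : closure (Complex.im ⁻¹' Set.Ioo a b) ⊆ Complex.im ⁻¹' Set.Icc a b :=
        closure_minimal (Set.preimage_mono Set.Ioo_subset_Icc_self)
          (isClosed_Icc.preimage Complex.continuous_im)
      have hw' := hcl hw
      exact ((hf w).div (hh w) (norm_pos_iff.1 (hpos w hw'.1 hw'.2))).differentiableWithinAt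
    · refine IsBigO.of_bound (A / m) ?_
      refine Eventually.filter_mono inf_le_right (eventually_principal.2 fun w hw => ?_)
      have h1 := hhm w hw.1.le hw.2.le
      have h2 := hgrowth w hw.1.le hw.2.le
      rw [norm_div, Real.norm_eq_abs, Real.abs_exp, div_mul_eq_mul_div]
      exact div_le_div₀ ((norm_nonneg _).trans h2) h2 hm h1
    · intro w hw
      rw [norm_div, div_le_iff₀ (hpos w hw.ge (hw.trans_le hab))]
      exact ha w hw
    · intro w hw
      rw [norm_div, div_le_iff₀ (hpos w (hab.trans_eq hw.symm) hw.le)]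
      exact hb w hw
  rw [norm_div, div_le_iff₀ (hpos ζ hζa hζb)] at key
  exact key

theorem exists_norm_stableJump_le_of_eventually {α : ℝ} (hα₀ : 0 < α) (hα₁ : α < 1) {A Ξ : ℝ}
    {S : Set ℂ} (h : ∀ ζ ∈ S, Ξ ≤ ζ.re → ‖stableJump α ζ‖ ≤ A * Real.exp ζ.re) :
    ∃ A' : ℝ, 0 ≤ A' ∧ ∀ ζ ∈ S, ‖stableJump α ζ‖ ≤ A' * (1 + Real.exp ζ.re) := by
  obtain ⟨C, hC, hg⟩ := exists_norm_stableJump_le_exp hα₀ hα₁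
  refine ⟨max A 0 + 4 * Real.exp (C * Real.exp Ξ), by positivity, fun ζ hζ => ?_⟩
  have hm := le_max_right A 0
  have hx := Real.exp_pos ζ.re
  have hE := Real.exp_pos (C * Real.exp Ξ)
  rcases le_total Ξ ζ.re with h1 | h1
  · have h2 := h ζ hζ h1
    have h3 := mul_le_mul_of_nonneg_right (le_max_left A 0) hx.le
    nlinarith [mul_pos hE hx]
  · have h2 : Real.exp (C * Real.exp ζ.re) ≤ Real.exp (C * Real.exp Ξ) := by gcongr
    nlinarith [hg ζ, mul_pos hE hx, mul_nonneg hm hx.le]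

theorem sq_add_sq_le_norm_add_sq {w : ℂ} {l : ℝ} (hl : 0 ≤ l) (hw : 0 ≤ w.re) :
    l ^ 2 + ‖w‖ ^ 2 ≤ ‖w + l‖ ^ 2 := by
  rw [Complex.sq_norm, Complex.sq_norm, Complex.normSq_add]
  simp only [Complex.normSq_ofReal, Complex.conj_ofReal, Complex.mul_re, Complex.ofReal_re,
    Complex.ofReal_im, mul_zero, sub_zero]
  nlinarith [mul_nonneg hl hw]

theorem exp_div_re_nonneg {ζ : ℂ} (h : |ζ.im| ≤ Real.pi) {n : ℝ} (hn : 2 ≤ n) :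
    0 ≤ (Complex.exp (ζ / n)).re := by
  have hp := Real.pi_pos
  rw [Complex.exp_re, Complex.div_ofReal_im]
  refine mul_nonneg (Real.exp_pos _).le ?_
  rw [← Real.cos_abs, abs_div, abs_of_pos (by linarith : 0 < n)]
  refine Real.cos_nonneg_of_neg_pi_div_two_le_of_le ?_ ?_
  · exact le_trans (by linarith) (div_nonneg (abs_nonneg _) (by linarith))
  · rw [div_le_div_iff₀ (by linarith) two_pos]
    nlinarith [abs_nonneg ζ.im]

theorem norm_exp_div_sq (ζ : ℂ) (n : ℝ) :
    ‖Complex.exp (ζ / n)‖ ^ 2 = Real.exp (2 * ζ.re / n) := by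
  rw [Complex.norm_exp, ← Real.exp_nat_mul, Complex.div_ofReal_re]
  congr 1
  push_cast
  ring

/-- The bound `O(1 + e^{Re ζ})` for `T` passes from the edges of a strip to its interior. The weight
is `(e^{ζ / 2} + 1) ^ 2`, whose modulus is comparable to `1 + e^{Re ζ}` for `|Im ζ| ≤ π`. -/
theorem norm_stableJump_le_of_strip {α : ℝ} (hα₀ : 0 < α) (hα₁ : α < 1) {a b K : ℝ} (hab : a < b)
    (hba : b - a ≤ Real.pi / 2) (ha : -Real.pi ≤ a) (hb : b ≤ Real.pi) (hK : 0 ≤ K)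
    (hTa : ∀ ζ : ℂ, ζ.im = a → ‖stableJump α ζ‖ ≤ K * (1 + Real.exp ζ.re))
    (hTb : ∀ ζ : ℂ, ζ.im = b → ‖stableJump α ζ‖ ≤ K * (1 + Real.exp ζ.re))
    {ζ : ℂ} (hζa : a ≤ ζ.im) (hζb : ζ.im ≤ b) :
    ‖stableJump α ζ‖ ≤ 2 * K * (1 + Real.exp ζ.re) := by
  obtain ⟨C, hC, hg⟩ := exists_norm_stableJump_le_exp hα₀ hα₁
  have hp := Real.pi_pos
  have him : ∀ ζ : ℂ, a ≤ ζ.im → ζ.im ≤ b → |ζ.im| ≤ Real.pi := fun ζ h1 h2 =>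
    abs_le.2 ⟨ha.trans h1, h2.trans hb⟩
  have hlow : ∀ ζ : ℂ, a ≤ ζ.im → ζ.im ≤ b →
      1 + Real.exp ζ.re ≤ ‖(Complex.exp (ζ / (2 : ℝ)) + (1 : ℝ)) ^ 2‖ := by
    intro ζ h1 h2
    have := sq_add_sq_le_norm_add_sq zero_le_one (exp_div_re_nonneg (him ζ h1 h2) le_rfl)
    rw [norm_exp_div_sq, mul_div_cancel_left₀ _ two_ne_zero, one_pow] at this
    rwa [norm_pow]
  have key := norm_le_mul_norm_of_strip (f := stableJump α) (a := a) (b := b) (m := 1) (K := K)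
    (h := fun ζ => (Complex.exp (ζ / (2 : ℝ)) + (1 : ℝ)) ^ 2) (A := 4) (B := C) (c := 1)
    (differentiable_stableJump hα₀ hα₁) (by fun_prop) one_pos
    (fun ζ h1 h2 => le_trans (by linarith [Real.exp_pos ζ.re]) (hlow ζ h1 h2))
    (by rw [lt_div_iff₀ (by linarith)]; linarith)
    (fun ζ _ _ => (hg ζ).trans (by
      have := le_abs_self ζ.re
      rw [one_mul]
      gcongr)) hab.le
    (fun ζ h => (hTa ζ h).trans
      (mul_le_mul_of_nonneg_left (hlow ζ h.ge (h.trans_le hab.le)) hK))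
    (fun ζ h => (hTb ζ h).trans
      (mul_le_mul_of_nonneg_left (hlow ζ (hab.le.trans_eq h.symm) h.le) hK)) hζa hζb
  refine key.trans ?_
  rw [mul_comm 2 K, mul_assoc]
  refine mul_le_mul_of_nonneg_left ?_ hK
  rw [norm_pow]
  have h1 : ‖Complex.exp (ζ / (2 : ℝ)) + (1 : ℝ)‖ ≤ ‖Complex.exp (ζ / (2 : ℝ))‖ + 1 := by
    refine (norm_add_le _ _).trans (le_of_eq ?_)
    simp
  have h2 := norm_exp_div_sq ζ 2
  rw [mul_div_cancel_left₀ _ two_ne_zero] at h2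
  rw [← h2]
  nlinarith [norm_nonneg (Complex.exp (ζ / (2 : ℝ)) + (1 : ℝ)),
    sq_nonneg (‖Complex.exp (ζ / (2 : ℝ))‖ - 1), norm_nonneg (Complex.exp (ζ / (2 : ℝ)))]

theorem exists_norm_stableJump_le {α : ℝ} (hα₀ : 0 < α) (hα₁ : α < 1) :
    ∃ K : ℝ, 0 ≤ K ∧ ∀ ζ : ℂ, |ζ.im| ≤ Real.pi → ‖stableJump α ζ‖ ≤ K * (1 + Real.exp ζ.re) := by
  have hp := Real.pi_pos
  obtain ⟨A₀, h₀⟩ := exists_norm_stableJump_real_le hα₀ hα₁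
  obtain ⟨A₁, h₁⟩ := exists_norm_stableJump_pi_div_two_le hα₀ hα₁
  obtain ⟨Ξ, hΞ⟩ := exists_norm_stableRemainder_pi_le hα₀ hα₁ one_pos
  obtain ⟨K₀, hK₀, h₀'⟩ := exists_norm_stableJump_le_of_eventually hα₀ hα₁ (S := {ζ | ζ.im = 0})
    (A := A₀) (Ξ := 0) (fun ζ h h' => h₀ ζ h h')
  obtain ⟨K₁, hK₁, h₁'⟩ := exists_norm_stableJump_le_of_eventually hα₀ hα₁
    (S := {ζ | ζ.im = Real.pi / 2}) (A := A₁) (Ξ := 0) (fun ζ h h' => h₁ ζ h h')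
  obtain ⟨K₂, hK₂, h₂'⟩ := exists_norm_stableJump_le_of_eventually hα₀ hα₁
    (S := {ζ | ζ.im = Real.pi}) (A := 1 + 2 * Real.pi * stableC α) (Ξ := max 0 Ξ) (by
      intro ζ h h'
      have h1 := hΞ ζ (by rw [show ζ.im = Real.pi from h, abs_of_pos hp])
        ((le_max_right _ _).trans h')
      have h2 : Real.exp (ζ.re / 2) ≤ Real.exp ζ.re := by
        have := (le_max_left 0 Ξ).trans h'
        rw [Real.exp_le_exp]; linarith
      have hc := stableC_pos hα₀ hα₁
      have h3 : 0 ≤ 1 + 2 * Real.pi * stableC α := by positivity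
      have := norm_stableJump_le hα₀ hα₁ ζ
      have := mul_le_mul_of_nonneg_left h2 h3
      linarith)
  set K := max K₀ (max K₁ K₂)
  have hK : 0 ≤ K := hK₀.trans (le_max_left _ _)
  have hup : ∀ ζ : ℂ, 0 ≤ ζ.im → ζ.im ≤ Real.pi →
      ‖stableJump α ζ‖ ≤ 2 * K * (1 + Real.exp ζ.re) := by
    have e₀ : ∀ ζ : ℂ, ζ.im = 0 → ‖stableJump α ζ‖ ≤ K * (1 + Real.exp ζ.re) := fun ζ h =>
      (h₀' ζ h).trans (by gcongr; exact le_max_left _ _)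
    have e₁ : ∀ ζ : ℂ, ζ.im = Real.pi / 2 → ‖stableJump α ζ‖ ≤ K * (1 + Real.exp ζ.re) := fun ζ h =>
      (h₁' ζ h).trans (by gcongr; exact (le_max_left _ _).trans (le_max_right _ _))
    have e₂ : ∀ ζ : ℂ, ζ.im = Real.pi → ‖stableJump α ζ‖ ≤ K * (1 + Real.exp ζ.re) := fun ζ h =>
      (h₂' ζ h).trans (by gcongr; exact (le_max_right _ _).trans (le_max_right _ _))
    intro ζ h1 h2
    rcases le_total ζ.im (Real.pi / 2) with h | h
    · exact norm_stableJump_le_of_strip hα₀ hα₁ (by linarith) (by linarith) (by linarith)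
        (by linarith) hK e₀ e₁ h1 h
    · exact norm_stableJump_le_of_strip hα₀ hα₁ (by linarith) (by linarith) (by linarith)
        (by linarith) hK e₁ e₂ h h2
  refine ⟨2 * K, by positivity, fun ζ hζ => ?_⟩
  rcases le_total 0 ζ.im with h | h
  · exact hup ζ h (abs_le.1 hζ).2
  · have := hup (starRingEnd ℂ ζ) (by simpa using h) (by simpa using neg_le.1 (abs_le.1 hζ).1)
    rwa [norm_stableJump_conj, Complex.conj_re] at this

/-- The asymptotic form of `T` holds uniformly in `|Im ζ| ≤ π`. The polynomial bound in the interior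
and the limits on the two edges suffice: the strip has width `2π`, and the remainder grows only like
`e^{|Re ζ|}`. -/
theorem exists_norm_stableRemainder_le {α : ℝ} (hα₀ : 0 < α) (hα₁ : α < 1) {ε : ℝ} (hε : 0 < ε) :
    ∃ Ξ : ℝ, ∀ ζ : ℂ, |ζ.im| ≤ Real.pi → Ξ ≤ ζ.re →
      ‖stableRemainder α ζ‖ ≤ ε * Real.exp (ζ.re / 2) := by
  have hp := Real.pi_pos
  have hc := stableC_pos hα₀ hα₁
  obtain ⟨K₀, hK₀, hT⟩ := exists_norm_stableJump_le hα₀ hα₁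
  obtain ⟨Ξ, hΞ⟩ := exists_norm_stableRemainder_pi_le hα₀ hα₁ (ε := ε / 4) (by positivity)
  set K := K₀ + 2 * Real.pi * stableC α
  have hK : 0 ≤ K := by positivity
  have hD : ∀ ζ : ℂ, |ζ.im| ≤ Real.pi → ‖stableRemainder α ζ‖ ≤ K * (1 + Real.exp ζ.re) := by
    intro ζ hζ
    have h1 : Real.exp (ζ.re / 2) ≤ 1 + Real.exp ζ.re := by
      have : Real.exp ζ.re = Real.exp (ζ.re / 2) ^ 2 := by
        rw [← Real.exp_nat_mul]; congr 1; push_cast; ring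
      rw [this]
      nlinarith [sq_nonneg (Real.exp (ζ.re / 2) - 1), Real.exp_pos (ζ.re / 2)]
    have h2 := mul_le_mul_of_nonneg_left h1 (by positivity : 0 ≤ 2 * Real.pi * stableC α)
    linarith [norm_stableRemainder_le hα₀ hα₁ ζ, hT ζ hζ]
  -- the weight `|exp (ζ / 4) + l| ^ 2` absorbs the part of the boundary where `Re ζ` is small
  set l := max 1 (K * (1 + Real.exp Ξ) / (ε / 4)) with hl
  have hl1 : 1 ≤ l := le_max_left _ _
  have hl0 : 0 ≤ l := by linarith
  have hlK : K * (1 + Real.exp Ξ) ≤ ε / 4 * l ^ 2 := by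
    have h1 : K * (1 + Real.exp Ξ) / (ε / 4) ≤ l := le_max_right _ _
    rw [div_le_iff₀ (by positivity)] at h1
    nlinarith [mul_le_mul_of_nonneg_right hl1 hl0]
  have hlow : ∀ ζ : ℂ, |ζ.im| ≤ Real.pi →
      l ^ 2 + Real.exp (ζ.re / 2) ≤ ‖(Complex.exp (ζ / (4 : ℝ)) + l) ^ 2‖ := by
    intro ζ h
    have := sq_add_sq_le_norm_add_sq hl0 (exp_div_re_nonneg h (n := 4) (by norm_num))
    rw [norm_exp_div_sq, show 2 * ζ.re / 4 = ζ.re / 2 by ring] at this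
    rwa [norm_pow]
  have hedge : ∀ ζ : ℂ, |ζ.im| = Real.pi →
      ‖stableRemainder α ζ‖ ≤ ε / 4 * ‖(Complex.exp (ζ / (4 : ℝ)) + l) ^ 2‖ := by
    intro ζ h
    have h1 := mul_le_mul_of_nonneg_left (hlow ζ h.le) (by positivity : 0 ≤ ε / 4)
    have h2 : 0 ≤ ε / 4 * Real.exp (ζ.re / 2) := by positivity
    have h3 : 0 ≤ ε / 4 * l ^ 2 := by positivity
    rcases le_total Ξ ζ.re with h4 | h4
    · linarith [hΞ ζ h h4]
    · have h5 : K * (1 + Real.exp ζ.re) ≤ K * (1 + Real.exp Ξ) := by gcongr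
      linarith [hD ζ h.le]
  have key : ∀ ζ : ℂ, |ζ.im| ≤ Real.pi →
      ‖stableRemainder α ζ‖ ≤ ε / 4 * ‖(Complex.exp (ζ / (4 : ℝ)) + l) ^ 2‖ := by
    intro ζ hζ
    refine norm_le_mul_norm_of_strip (f := stableRemainder α) (a := -Real.pi) (b := Real.pi)
      (m := 1) (h := fun ζ => (Complex.exp (ζ / (4 : ℝ)) + l) ^ 2)
      (A := 2 * K) (B := 4) (c := 1 / 4)
      (differentiable_stableRemainder hα₀ hα₁) (by fun_prop) one_pos
      (fun ζ h1 h2 => le_trans ?_ (hlow ζ (abs_le.2 ⟨h1, h2⟩))) ?_ (fun ζ h1 h2 => ?_)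
      (by linarith) (fun ζ h => hedge ζ (by rw [h, abs_neg, abs_of_pos hp]))
      (fun ζ h => hedge ζ (by rw [h, abs_of_pos hp])) (abs_le.1 hζ).1 (abs_le.1 hζ).2
    · nlinarith [Real.exp_pos (ζ.re / 2)]
    · rw [lt_div_iff₀ (by linarith)]; linarith
    · refine (hD ζ (abs_le.2 ⟨h1, h2⟩)).trans ?_
      rw [mul_comm 2 K, mul_assoc]
      refine mul_le_mul_of_nonneg_left ?_ hK
      have h3 : |ζ.re| ≤ 4 * Real.exp (1 / 4 * |ζ.re|) := by
        linarith [Real.add_one_le_exp (1 / 4 * |ζ.re|)]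
      have h4 : Real.exp ζ.re ≤ Real.exp (4 * Real.exp (1 / 4 * |ζ.re|)) := by
        rw [Real.exp_le_exp]; exact (le_abs_self _).trans h3
      have h5 : 1 ≤ Real.exp (4 * Real.exp (1 / 4 * |ζ.re|)) := Real.one_le_exp (by positivity)
      linarith
  refine ⟨4 * Real.log l, fun ζ hζ hre => (key ζ hζ).trans ?_⟩
  have h1 : l ≤ Real.exp (ζ.re / 4) := by
    rw [← Real.log_le_iff_le_exp (by linarith)]; linarith
  have h2 : ‖Complex.exp (ζ / (4 : ℝ)) + l‖ ≤ 2 * Real.exp (ζ.re / 4) := by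
    refine (norm_add_le _ _).trans ?_
    rw [Complex.norm_exp, Complex.div_ofReal_re, Complex.norm_real, Real.norm_eq_abs,
      abs_of_nonneg hl0]
    linarith
  have h3 : Real.exp (ζ.re / 2) = Real.exp (ζ.re / 4) ^ 2 := by
    rw [← Real.exp_nat_mul]; congr 1; push_cast; ring
  rw [norm_pow, h3]
  calc _ ≤ ε / 4 * (2 * Real.exp (ζ.re / 4)) ^ 2 := by gcongr
    _ = _ := by ring

/-! ### Asymptotics of `G_α` -/

theorem stableG_eq_stableBranch {α : ℝ} (hα₀ : 0 < α) (hα₁ : α < 1) {z : ℂ} (hz : z ≠ 0) :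
    stableG α z = (2 * Complex.I * (Real.pi : ℂ))⁻¹ * (z⁻¹ *
      (stableBranch α (Complex.log z + Real.pi * Complex.I) -
        stableBranch α (Complex.log z - Real.pi * Complex.I))) := by
  have hi : ∀ q : ℂ, IntegrableOn (fun t : ℝ => Complex.exp (-(t : ℂ) * 1 + ((t ^ α : ℝ) : ℂ) * q))
      (Set.Ioi 0) := fun q => integrableOn_expPow hα₀ hα₁ (by simp) q
  unfold stableG
  congr 1
  rw [stableBranch, stableBranch, expPowIntegral, expPowIntegral, ← integral_sub (hi _) (hi _),
    ← integral_const_mul]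
  refine integral_congr_ae (Eventually.of_forall fun y => ?_)
  -- `e^{iπ(1 - α)} = -e^{-iπα}`, and conjugately
  have e1 : Complex.exp ((1 - α) * (Complex.log z + Real.pi * Complex.I)) =
      -(Complex.exp (-(Complex.I * Real.pi * α)) * z ^ ((1 - α : ℝ) : ℂ)) := by
    rw [Complex.cpow_def_of_ne_zero hz, ← Complex.exp_add, ← Complex.exp_add_pi_mul_I]
    push_cast
    ring_nf
  have e2 : Complex.exp ((1 - α) * (Complex.log z - Real.pi * Complex.I)) =
      -(Complex.exp (Complex.I * Real.pi * α) * z ^ ((1 - α : ℝ) : ℂ)) := by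
    rw [Complex.cpow_def_of_ne_zero hz, ← Complex.exp_add, ← Complex.exp_sub_pi_mul_I]
    push_cast
    ring_nf
  simp only
  rw [e1, e2, div_mul_eq_mul_div, div_eq_inv_mul, sub_mul, ← Complex.exp_add, ← Complex.exp_add]
  ring_nf

theorem stableG_sub_eq {α : ℝ} (hα₀ : 0 < α) (hα₁ : α < 1) {z : ℂ} (hz : z ≠ 0) :
    stableG α z - stableC α * z ^ (-(1 / 2) : ℂ) * Complex.exp (-(stableDelta α * z)) =
      (2 * Complex.I * (Real.pi : ℂ))⁻¹ * z⁻¹ * Complex.exp (-(stableDelta α * z)) *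
        stableRemainder α (Complex.log z) := by
  rw [stableG_eq_stableBranch hα₀ hα₁ hz, stableRemainder, stableJump, Complex.exp_log hz]
  have e1 : Complex.exp (-(stableDelta α * z)) * Complex.exp (stableDelta α * z) = 1 := by
    rw [← Complex.exp_add, neg_add_cancel, Complex.exp_zero]
  have e2 : z ^ (-(1 / 2) : ℂ) = z⁻¹ * Complex.exp (Complex.log z / 2) := by
    nth_rewrite 2 [← Complex.exp_log hz]
    rw [Complex.cpow_def_of_ne_zero hz, ← Complex.exp_neg, ← Complex.exp_add]
    ring_nf
  have e3 : (2 * Complex.I * (Real.pi : ℂ))⁻¹ * (2 * Complex.I * (Real.pi : ℂ)) = 1 :=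
    inv_mul_cancel₀ (by simp [Real.pi_pos.ne'])
  rw [e2]
  linear_combination (-(2 * Complex.I * (Real.pi : ℂ))⁻¹ * z⁻¹ *
      (stableBranch α (Complex.log z + Real.pi * Complex.I) -
        stableBranch α (Complex.log z - Real.pi * Complex.I))) * e1 +
    (z⁻¹ * Complex.exp (-(stableDelta α * z)) * stableC α * Complex.exp (Complex.log z / 2)) * e3

/-- The asymptotic formula for `G_α(z)`, uniform in the argument of `z`. -/
theorem exists_norm_stableG_sub_le {α : ℝ} (hα₀ : 0 < α) (hα₁ : α < 1) {ε : ℝ} (hε : 0 < ε) :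
    ∃ R : ℝ, 0 < R ∧ ∀ z : ℂ, R ≤ ‖z‖ →
      ‖stableG α z - stableC α * z ^ (-(1 / 2) : ℂ) * Complex.exp (-(stableDelta α * z))‖ ≤
        ε * ‖z ^ (-(1 / 2) : ℂ) * Complex.exp (-(stableDelta α * z))‖ := by
  have hp := Real.pi_gt_three
  obtain ⟨Ξ, hΞ⟩ := exists_norm_stableRemainder_le hα₀ hα₁ hε
  refine ⟨Real.exp Ξ, Real.exp_pos _, fun z hz => ?_⟩
  have hzn : 0 < ‖z‖ := (Real.exp_pos _).trans_le hz
  have hz0 : z ≠ 0 := norm_pos_iff.1 hzn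
  have h1 := hΞ (Complex.log z) (by rw [Complex.log_im]; exact Complex.abs_arg_le_pi z)
    (by rw [Complex.log_re]; exact (Real.le_log_iff_exp_le hzn).2 hz)
  have e1 : ‖z ^ (-(1 / 2) : ℂ)‖ = ‖z‖⁻¹ * Real.exp ((Complex.log z).re / 2) := by
    rw [Complex.cpow_def_of_ne_zero hz0, Complex.norm_exp]
    have e : ‖z‖⁻¹ = Real.exp (-(Complex.log z).re) := by
      rw [Complex.log_re, Real.exp_neg, Real.exp_log hzn]
    rw [e, ← Real.exp_add]
    congr 1
    simp
    ring
  have e2 : ‖(2 * Complex.I * (Real.pi : ℂ))⁻¹‖ ≤ 1 := by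
    rw [norm_inv]
    refine inv_le_one_of_one_le₀ ?_
    simp only [norm_mul, Complex.norm_I, Complex.norm_real, Real.norm_eq_abs,
      abs_of_pos Real.pi_pos, Complex.norm_ofNat]
    linarith
  rw [stableG_sub_eq hα₀ hα₁ hz0, norm_mul, norm_mul, norm_mul, norm_mul, e1, norm_inv z]
  calc _ ≤ 1 * ‖z‖⁻¹ * ‖Complex.exp (-(stableDelta α * z))‖ *
        (ε * Real.exp ((Complex.log z).re / 2)) := by gcongr
    _ = _ := by ring

theorem isEquivalent_of_forall_norm_sub_le {c : ℂ} (hc : c ≠ 0) {u v : ℝ → ℂ}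
    (h : ∀ ε : ℝ, 0 < ε → ∀ᶠ r in atTop, ‖u r - c * v r‖ ≤ ε * ‖v r‖) :
    u ~[atTop] fun r => c * v r := by
  have h1 : (fun r => u r - c * v r) =o[atTop] v := isLittleO_iff.2 fun ε hε => h ε hε
  have h2 : v =O[atTop] fun r => c * v r := (isBigO_refl v atTop).const_mul_right hc
  exact h1.trans_isBigO h2

theorem tendsto_stableG_of_tendsto_log {α r : ℝ} (hα₀ : 0 < α) (hα₁ : α < 1) (hr : 0 < r)
    {F : Filter ℂ} {ℓ : ℂ} (hF : F ≤ 𝓝 (-(r : ℂ))) (hℓ : Tendsto Complex.log F (𝓝 ℓ)) :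
    Tendsto (stableG α) F (𝓝 ((2 * Complex.I * (Real.pi : ℂ))⁻¹ * ((-(r : ℂ))⁻¹ *
      (stableBranch α (ℓ + Real.pi * Complex.I) - stableBranch α (ℓ - Real.pi * Complex.I))))) := by
  have hr0 : -(r : ℂ) ≠ 0 := by simp [hr.ne']
  have hne : ∀ᶠ z in F, z ≠ 0 := hF (isOpen_ne.mem_nhds hr0)
  have hL := (differentiable_stableBranch hα₀ hα₁).continuous
  have h1 := (hL.tendsto _).comp (hℓ.add_const (Real.pi * Complex.I))
  have h2 := (hL.tendsto _).comp (hℓ.sub_const (Real.pi * Complex.I))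
  have h3 : Tendsto (fun z : ℂ => z⁻¹) F (𝓝 (-(r : ℂ))⁻¹) := (tendsto_inv₀ hr0).mono_left hF
  refine ((h3.mul (h1.sub h2)).const_mul _).congr' ?_
  filter_upwards [hne] with z hz
  rw [stableG_eq_stableBranch hα₀ hα₁ hz]
  rfl

theorem tendsto_log_upper {r : ℝ} (hr : 0 < r) :
    Tendsto Complex.log (𝓝[{z : ℂ | 0 < z.im}] (-(r : ℂ)))
      (𝓝 (Real.log r + Real.pi * Complex.I)) := by
  have h := Complex.tendsto_log_nhdsWithin_im_nonneg_of_re_neg_of_im_zero (z := -(r : ℂ))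
    (by simpa using hr) (by simp)
  rw [norm_neg, Complex.norm_real, Real.norm_eq_abs, abs_of_pos hr] at h
  exact h.mono_left (nhdsWithin_mono _ fun z (hz : 0 < z.im) => hz.le)

theorem tendsto_log_lower {r : ℝ} (hr : 0 < r) :
    Tendsto Complex.log (𝓝[{z : ℂ | z.im < 0}] (-(r : ℂ)))
      (𝓝 (Real.log r - Real.pi * Complex.I)) := by
  have h := Complex.tendsto_log_nhdsWithin_im_neg_of_re_neg_of_im_zero (z := -(r : ℂ))
    (by simpa using hr) (by simp)
  rwa [norm_neg, Complex.norm_real, Real.norm_eq_abs, abs_of_pos hr] at h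

theorem neBot_nhdsWithin_upper (r : ℝ) : (𝓝[{z : ℂ | 0 < z.im}] (-(r : ℂ))).NeBot := by
  rw [← mem_closure_iff_nhdsWithin_neBot, Complex.closure_setOfPred_lt_im]
  simp

theorem neBot_nhdsWithin_lower (r : ℝ) : (𝓝[{z : ℂ | z.im < 0}] (-(r : ℂ))).NeBot := by
  rw [← mem_closure_iff_nhdsWithin_neBot, Complex.closure_setOfPred_im_lt]
  simp

theorem tendsto_stableG_upper {α r : ℝ} (hα₀ : 0 < α) (hα₁ : α < 1) (hr : 0 < r) :
    Tendsto (stableG α) (𝓝[{z : ℂ | 0 < z.im}] (-(r : ℂ))) (𝓝 (stableGPlus α r)) := by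
  have h := tendsto_stableG_of_tendsto_log hα₀ hα₁ hr nhdsWithin_le_nhds (tendsto_log_upper hr)
  have := neBot_nhdsWithin_upper r
  exact tendsto_nhds_limUnder ⟨_, h⟩

theorem tendsto_stableG_lower {α r : ℝ} (hα₀ : 0 < α) (hα₁ : α < 1) (hr : 0 < r) :
    Tendsto (stableG α) (𝓝[{z : ℂ | z.im < 0}] (-(r : ℂ))) (𝓝 (stableGMinus α r)) := by
  have h := tendsto_stableG_of_tendsto_log hα₀ hα₁ hr nhdsWithin_le_nhds (tendsto_log_lower hr)
  have := neBot_nhdsWithin_lower r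
  exact tendsto_nhds_limUnder ⟨_, h⟩

theorem tendsto_cpow_mul_exp_of_tendsto_log {δ r : ℝ} (hr : 0 < r) {F : Filter ℂ} {σ : ℂ}
    (hF : F ≤ 𝓝 (-(r : ℂ))) (hℓ : Tendsto Complex.log F (𝓝 (Real.log r + σ))) :
    Tendsto (fun z : ℂ => z ^ (-(1 / 2) : ℂ) * Complex.exp (-(δ * z))) F
      (𝓝 (Complex.exp (-(σ / 2)) * ((r ^ (-(1 / 2) : ℝ) * Real.exp (δ * r) : ℝ) : ℂ))) := by
  have hr0 : -(r : ℂ) ≠ 0 := by simp [hr.ne']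
  have hne : ∀ᶠ z in F, z ≠ 0 := hF (isOpen_ne.mem_nhds hr0)
  have hid : Tendsto (fun z : ℂ => z) F (𝓝 (-(r : ℂ))) := hF
  have h1 := ((hℓ.mul_const (-(1 / 2) : ℂ)).cexp).mul ((hid.const_mul (δ : ℂ)).neg.cexp)
  have e1 : Complex.exp ((Real.log r + σ) * (-(1 / 2))) * Complex.exp (-(δ * -(r : ℂ))) =
      Complex.exp (-(σ / 2)) * ((r ^ (-(1 / 2) : ℝ) * Real.exp (δ * r) : ℝ) : ℂ) := by
    rw [Real.rpow_def_of_pos hr, ← Real.exp_add]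
    push_cast
    rw [← Complex.exp_add, ← Complex.exp_add]
    ring_nf
  rw [e1] at h1
  refine h1.congr' ?_
  filter_upwards [hne] with z hz
  rw [Complex.cpow_def_of_ne_zero hz]

/-- The uniform asymptotic formula passes to boundary values on the cut. The number `σ` is the limit
of `i arg z`, that is `iπ` from above and `-iπ` from below. -/
theorem isEquivalent_boundary_value {α : ℝ} (hα₀ : 0 < α) (hα₁ : α < 1) {F : ℝ → Filter ℂ} {σ : ℂ}
    {g : ℝ → ℂ} (hne : ∀ r, (F r).NeBot) (hF : ∀ r : ℝ, F r ≤ 𝓝 (-(r : ℂ)))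
    (hℓ : ∀ r : ℝ, 0 < r → Tendsto Complex.log (F r) (𝓝 (Real.log r + σ)))
    (hg : ∀ r, 0 < r → Tendsto (stableG α) (F r) (𝓝 (g r))) :
    g ~[atTop] fun r => (stableC α : ℂ) * (Complex.exp (-(σ / 2)) *
      ((r ^ (-(1 / 2) : ℝ) * Real.exp (stableDelta α * r) : ℝ) : ℂ)) := by
  refine isEquivalent_of_forall_norm_sub_le
    (Complex.ofReal_ne_zero.2 (stableC_pos hα₀ hα₁).ne') fun ε hε => ?_
  obtain ⟨R, hR, h⟩ := exists_norm_stableG_sub_le hα₀ hα₁ hε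
  filter_upwards [eventually_gt_atTop R] with r hr
  have hr0 : 0 < r := hR.trans hr
  have := hne r
  have h1 := tendsto_cpow_mul_exp_of_tendsto_log (δ := stableDelta α) hr0 (hF r) (hℓ r hr0)
  refine le_of_tendsto_of_tendsto ((hg r hr0).sub (h1.const_mul (stableC α : ℂ))).norm
    (h1.norm.const_mul ε) ?_
  have hnorm : ∀ᶠ z in F r, R < ‖z‖ := by
    refine hF r ((continuous_norm.tendsto (-(r : ℂ))).eventually (lt_mem_nhds ?_))
    simpa [abs_of_pos hr0] using hr
  filter_upwards [hnorm] with z hz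
  have := h z hz.le
  rwa [mul_assoc] at this

theorem mainTheorem4 (α : ℝ) (hα₀ : 0 < α) (hα₁ : α < 1) :
    -- asymptotics along each fixed ray `z = r e^{iπθ}`, `-1 < θ < 1`
    (∀ θ : ℝ, -1 < θ → θ < 1 →
      (fun r : ℝ => stableG α ((r : ℂ) * Complex.exp (Complex.I * (Real.pi : ℂ) * (θ : ℂ))))
        ~[atTop]
      (fun r : ℝ => (stableC α : ℂ) *
        ((r : ℂ) * Complex.exp (Complex.I * (Real.pi : ℂ) * (θ : ℂ))) ^ (-(1 / 2) : ℂ) *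
        Complex.exp (-((stableDelta α : ℂ) *
          ((r : ℂ) * Complex.exp (Complex.I * (Real.pi : ℂ) * (θ : ℂ))))))) ∧
    -- the boundary values on the cut exist as limits
    (∀ r : ℝ, 0 < r →
      Tendsto (stableG α) (𝓝[{z : ℂ | 0 < z.im}] (-(r : ℂ))) (𝓝 (stableGPlus α r)) ∧
      Tendsto (stableG α) (𝓝[{z : ℂ | z.im < 0}] (-(r : ℂ))) (𝓝 (stableGMinus α r))) ∧
    -- asymptotics of the boundary values
    ((fun r : ℝ => stableGPlus α r) ~[atTop]
      (fun r : ℝ => -(Complex.I * (stableC α : ℂ) *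
        ((r ^ (-(1 / 2) : ℝ) * Real.exp (stableDelta α * r) : ℝ) : ℂ)))) ∧
    ((fun r : ℝ => stableGMinus α r) ~[atTop]
      (fun r : ℝ => Complex.I * (stableC α : ℂ) *
        ((r ^ (-(1 / 2) : ℝ) * Real.exp (stableDelta α * r) : ℝ) : ℂ))) ∧
    -- uniform boundedness off the cut
    (∃ R : ℝ, 0 < R ∧ ∃ M : ℝ, ∀ z : ℂ, z ∈ Complex.slitPlane → R < ‖z‖ →
      ‖stableG α z * z ^ (1 / 2 : ℂ) * Complex.exp ((stableDelta α : ℂ) * z)‖ ≤ M) := by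
  have hc := stableC_pos hα₀ hα₁
  refine ⟨fun θ _ _ => ?_, fun r hr => ⟨tendsto_stableG_upper hα₀ hα₁ hr,
    tendsto_stableG_lower hα₀ hα₁ hr⟩, ?_, ?_, ?_⟩
  · simp only [mul_assoc (stableC α : ℂ)]
    refine isEquivalent_of_forall_norm_sub_le (Complex.ofReal_ne_zero.2 hc.ne') fun ε hε => ?_
    obtain ⟨R, hR, h⟩ := exists_norm_stableG_sub_le hα₀ hα₁ hε
    filter_upwards [eventually_ge_atTop R] with r hr
    have hn : ‖(r : ℂ) * Complex.exp (Complex.I * (Real.pi : ℂ) * (θ : ℂ))‖ = r := by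
      rw [norm_mul, Complex.norm_exp, Complex.norm_real, Real.norm_eq_abs,
        abs_of_pos (hR.trans_le hr)]
      simp
    have := h _ (hr.trans_eq hn.symm)
    rwa [mul_assoc (stableC α : ℂ)] at this
  · have h := isEquivalent_boundary_value hα₀ hα₁ neBot_nhdsWithin_upper
      (fun r => nhdsWithin_le_nhds) (fun r hr => tendsto_log_upper hr)
      (fun r hr => tendsto_stableG_upper hα₀ hα₁ hr)
    convert h using 2 with r
    rw [show -(Real.pi * Complex.I / 2 : ℂ) = -Real.pi / 2 * Complex.I by ring,
      Complex.exp_neg_pi_div_two_mul_I]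
    ring
  · have h := isEquivalent_boundary_value hα₀ hα₁ neBot_nhdsWithin_lower
      (σ := -(Real.pi * Complex.I))
      (fun r => nhdsWithin_le_nhds) (fun r hr => by
        rw [← sub_eq_add_neg]; exact tendsto_log_lower hr)
      (fun r hr => tendsto_stableG_lower hα₀ hα₁ hr)
    convert h using 2 with r
    rw [show -(-(Real.pi * Complex.I) / 2 : ℂ) = Real.pi / 2 * Complex.I by ring,
      Complex.exp_pi_div_two_mul_I]
    ring
  · obtain ⟨R, hR, h⟩ := exists_norm_stableG_sub_le hα₀ hα₁ one_pos
    refine ⟨R, hR, stableC α + 1, fun z _ hz => ?_⟩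
    have hz0 : z ≠ 0 := norm_pos_iff.1 (hR.trans hz)
    have h1 := h z hz.le
    set v := z ^ (-(1 / 2) : ℂ) * Complex.exp (-(stableDelta α * z)) with hv
    have hinv : ‖v‖ * ‖z ^ (1 / 2 : ℂ) * Complex.exp ((stableDelta α : ℂ) * z)‖ = 1 := by
      rw [← norm_mul, hv, mul_mul_mul_comm, ← Complex.cpow_add _ _ hz0, ← Complex.exp_add]
      simp
    have h2 : ‖stableG α z‖ ≤ (stableC α + 1) * ‖v‖ := by
      rw [mul_assoc, ← hv] at h1
      have h3 := norm_le_norm_add_norm_sub' (stableG α z) (stableC α * v)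
      rw [norm_mul, Complex.norm_real, Real.norm_eq_abs, abs_of_pos hc] at h3
      linarith
    rw [mul_assoc, norm_mul]
    calc _ ≤ (stableC α + 1) * ‖v‖ *
          ‖z ^ (1 / 2 : ℂ) * Complex.exp ((stableDelta α : ℂ) * z)‖ := by gcongr
      _ = _ := by rw [mul_assoc, hinv, mul_one]
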